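/- **Conventions.** Let $\Bbbk$ be a field and let $H$ be a $\Bbbk$-Hopf algebra with invertible antipode. A left-right Yetter–Drinfel'd module over $H$ (an object of ${}_H\mathcal{YD}^H$) is a left $H$-module and right $H$-comodule $M$ with $h_{(1)}\cdot m_{(0)}\otimes h_{(2)}m_{(1)}=(h_{(2)}\cdot m)_{(0)}\otimes (h_{(2)}\cdot m)_{(1)}h_{(1)}$. A braided commutative algebra $A$ in ${}_H\mathcal{YD}^H$ is a $\Bbbk$-algebra that is a Yetter–Drinfel'd module with $$h\cdot(ab)=(h_{(1)}\cdot a)(h_{(2)}\cdot b),\quad h\cdot 1=\varepsilon_H(h)1,\quad (ab)_{(0)}\otimes(ab)_{(1)}=a_{(0)}b_{(0)}\otimes b_{(1)}a_{(1)},\quad 1_{(0)}\otimes 1_{(1)}=1\otimes 1,\quad b_{(0)}(b_{(1)}\cdot a)=ab .$$ The *scalar extension Hopf algebroid* $\mathcal H=A\#H$ over $A$ is $A\otimes H$ with product $(a\#h)(b\#g)=a(h_{(1)}\cdot b)\#h_{(2)}g$, unit $1\#1$, source $s(a)=a\#1$, target $t(a)=a_{(0)}\#a_{(1)}$, coproduct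 $\Delta(a\#h)=(a\#h_{(1)})\otimes_A(1\#h_{(2)})$ and counit $\varepsilon(a\#h)=\varepsilon_H(h)a$. Here $\mathcal H\otimes_A M$, for a left $A$-module $M$, is the quotient of $\mathcal H\otimes M$ by the relations $t(a)x\otimes m=x\otimes am$; left $\mathcal H$-modules are left $A$-modules via $s$. Put $\mathcal H^+=\ker\varepsilon$, $H^+=\ker\varepsilon_H$. A *left covariant first order differential calculus* on $\mathcal H$ consists of an $\mathcal H$-bimodule $\Omega$, a linear map $\mathrm d\colon\mathcal H\to\Omega$ and a left $\mathcal H$-coaction $\lambda\colon\Omega\to\mathcal H\otimes_A\Omega$, $\omega\mapsto\omega_{(-1)}\otimes_A\omega_{(0)}$ (left $A$-linear, coassociative, counital) such that * $\mathrm d(s(a)\,x\,s(b))=s(a)\,(\mathrm dx)\,s(b)$ and $\mathrm d(xy)=(\mathrm dx)y+x\,\mathrm dy$ for $a,b\in A$, $x,y\in\mathcal H$, and $\Omega$ is spanned by the elements $x\,\mathrm dy$; * the right $A$-action induced by the coaction is the one given by $s$, that is, $\varepsilon(\omega_{(-1)}s(a))\,\omega_{(0)}=\omega\, s(a)$; moreover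 $\lambda$ takes values in the Takeuchi subspace, that is, $\omega_{(-1)}t(a)\otimes_A\omega_{(0)}=\omega_{(-1)}\otimes_A\omega_{(0)}s(a)$, and $\lambda(x\omega y)=\Delta(x)\lambda(\omega)\Delta(y)$; * $\lambda\circ\mathrm d=(\mathrm{id}\otimes_A\mathrm d)\circ\Delta$. **Proposition 3.6.** Let $A$ be a braided commutative algebra in ${}_H\mathcal{YD}^H$, let $I_A\subseteq A$ be a left ideal that is also an $H$-submodule, and let $I_H\subseteq H$ be a left ideal contained in $H^+$. Then $\mathcal H=A\#H$ is a left bialgebroid over $A$ that is a right Hopf algebroid (that is, $x\otimes y\mapsto x_{(1)}y\otimes_A x_{(2)}$ is a bijection onto $\mathcal H\otimes_A\mathcal H$ from the quotient of $\mathcal H\otimes\mathcal H$ by $xs(a)\otimes y=x\otimes s(a)y$), and the span $I_A\#I_H$ of all $a\#h$ with $a\in I_A$, $h\in I_H$ is a left ideal of $\mathcal H$ contained in $\mathcal H^+$. Moreover $$\Omega:=\mathcal H\otimes_A\mathcal H^+/(I_A\#I_H)$$ is a left covariant first order differential calculus on $\mathcal H$ with the structure maps (well defined on $\Omega$) $$x\cdot(g\otimes_A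 q)=x_{(1)}g\otimes_A x_{(2)}q,\qquad (g\otimes_A q)\cdot x=gx\otimes_A q,\qquad \lambda(g\otimes_A q)=g_{(1)}\otimes_A(g_{(2)}\otimes_A q)$$ and the differential $$\mathrm d x=(\mathrm{id}\otimes_A\pi)(\Delta x-x\otimes_A1),\quad\text{i.e.}\quad \mathrm d(a\#h)=(\mathrm{id}\otimes_A\pi)\big((a\#h_{(1)})\otimes_A(1\#h_{(2)})-(a\#h)\otimes_A(1\#1)\big),$$ where $\pi\colon\mathcal H^+\to\mathcal H^+/(I_A\#I_H)$ is the projection and $\Delta x-x\otimes_A 1$ lies in $\mathcal H\otimes_A\mathcal H^+\subseteq\mathcal H\otimes_A\mathcal H$. -/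

import Mathlib

open scoped TensorProduct
open MulOpposite

/-! ### Tensor products balanced over a noncommutative ring

A left `R`-module over a `k`-algebra `R` is a `k`-module `N` with a `k`-algebra morphism
`R →ₐ[k] Module.End k N`, and a right `R`-module `M` has one `Rᵐᵒᵖ →ₐ[k] Module.End k M`.
This allows several actions on the same space. -/

section BalancedTensor

variable {k R M N M' N' : Type*} [CommRing k] [Ring R] [Algebra k R]
  [AddCommGroup M] [Module k M] [AddCommGroup N] [Module k N]
  [AddCommGroup M'] [Module k M'] [AddCommGroup N'] [Module k N']

/-- The subspace of `M ⊗[k] N` spanned by all `m r ⊗ n - m ⊗ r n`. -/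
def balancedRel (ra : Rᵐᵒᵖ →ₐ[k] Module.End k M) (la : R →ₐ[k] Module.End k N) :
    Submodule k (M ⊗[k] N) :=
  Submodule.span k {w | ∃ (r : R) (m : M) (n : N), w = ra (op r) m ⊗ₜ[k] n - m ⊗ₜ[k] la r n}

/-- The balanced tensor product `M ⊗_R N` of a right and a left `R`-module. -/
abbrev BalTensor (ra : Rᵐᵒᵖ →ₐ[k] Module.End k M) (la : R →ₐ[k] Module.End k N) :=
  (M ⊗[k] N) ⧸ balancedRel ra la

/-- The projection `M ⊗[k] N → M ⊗_R N`. -/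
abbrev BalTensor.mk (ra : Rᵐᵒᵖ →ₐ[k] Module.End k M) (la : R →ₐ[k] Module.End k N) :
    M ⊗[k] N →ₗ[k] BalTensor ra la :=
  (balancedRel ra la).mkQ

/-- The map `f ⊗_R g` for `R`-linear `f` and `g`. -/
def BalTensor.map {ra : Rᵐᵒᵖ →ₐ[k] Module.End k M} {la : R →ₐ[k] Module.End k N}
    {ra' : Rᵐᵒᵖ →ₐ[k] Module.End k M'} {la' : R →ₐ[k] Module.End k N'}
    (f : M →ₗ[k] M') (g : N →ₗ[k] N')
    (hf : ∀ r m, f (ra (op r) m) = ra' (op r) (f m)) (hg : ∀ r n, g (la r n) = la' r (g n)) :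
    BalTensor ra la →ₗ[k] BalTensor ra' la' :=
  (balancedRel ra la).mapQ (balancedRel ra' la') (TensorProduct.map f g) (by
    refine Submodule.span_le.2 ?_
    rintro _ ⟨r, m, n, rfl⟩
    refine Submodule.subset_span ⟨r, f m, g n, ?_⟩
    simp [hf, hg])

end BalancedTensor

/-! ### Left bialgebroids -/

/-- An `Rᵉ`-ring: a `k`-algebra `E` with a source map `R → E` and a target map `Rᵐᵒᵖ → E`,
both algebra morphisms, whose images commute with each other. -/
structure EnvRing (k R E : Type*) [CommRing k] [Ring R] [Algebra k R] [Ring E] [Algebra k E] where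
  source : R →ₐ[k] E
  target : Rᵐᵒᵖ →ₐ[k] E
  commute : ∀ r r', source r * target r' = target r' * source r

namespace EnvRing

variable {k R E M : Type*} [CommRing k] [Ring R] [Algebra k R] [Ring E] [Algebra k E]
  [AddCommGroup M] [Module k M] (D : EnvRing k R E)

/-- The left action `r ▹ h = s(r) h`. -/
noncomputable def lact : R →ₐ[k] Module.End k E := (Algebra.lmul k E).comp D.source

/-- The right action `h ◃ r = t(r) h`. -/
noncomputable def ract : Rᵐᵒᵖ →ₐ[k] Module.End k E := (Algebra.lmul k E).comp D.target

/-- The right action `h ◂ r = h s(r)`. -/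
noncomputable def bract : Rᵐᵒᵖ →ₐ[k] Module.End k E :=
  (Algebra.lsmul k k E : Eᵐᵒᵖ →ₐ[k] Module.End k E).comp (AlgHom.op D.source)

/-- `E ⊗_R M`, where `E` is a right `R`-module by `h ◃ r = t(r) h`. -/
abbrev Tensor (la : R →ₐ[k] Module.End k M) := BalTensor D.ract la

/-- The projection `E ⊗[k] M → E ⊗_R M`. -/
noncomputable abbrev tmk (la : R →ₐ[k] Module.End k M) : E ⊗[k] M →ₗ[k] D.Tensor la := BalTensor.mk D.ract la

/-- The left `R`-action `r (h ⊗_R m) = s(r) h ⊗_R m` on `E ⊗_R M`. -/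
noncomputable def tensorAct (la : R →ₐ[k] Module.End k M) :
    R →ₐ[k] Module.End k (D.Tensor la) :=
  AlgHom.ofLinearMap
    { toFun := fun r => BalTensor.map (D.lact r) LinearMap.id
        (fun r' m => by simp [lact, ract, ← mul_assoc, D.commute]) (fun _ _ => rfl)
      map_add' := fun r r' => by
        refine Submodule.linearMap_qext _ (TensorProduct.ext' fun h m => ?_)
        simp [BalTensor.map, TensorProduct.add_tmul]
        rfl
      map_smul' := fun c r => by
        refine Submodule.linearMap_qext _ (TensorProduct.ext' fun h m => ?_)
        simp [BalTensor.map, ← TensorProduct.smul_tmul']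
        rfl }
    (by
      refine Submodule.linearMap_qext _ (TensorProduct.ext' fun h m => ?_)
      simp [BalTensor.map])
    (fun r r' => by
      refine Submodule.linearMap_qext _ (TensorProduct.ext' fun h m => ?_)
      simp [BalTensor.map]
      rfl)

/-- For fixed `m`, the map `E ⊗_R E → E ⊗_R (E ⊗_R M)`, `x ⊗ y ↦ x ⊗ (y ⊗ m)`. -/
noncomputable def assocAt (la : R →ₐ[k] Module.End k M) (m : M) :
    D.Tensor D.lact →ₗ[k] D.Tensor (D.tensorAct la) :=
  BalTensor.map LinearMap.id (D.tmk la ∘ₗ (TensorProduct.mk k E M).flip m)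
    (fun _ _ => rfl) (fun _ _ => rfl)

end EnvRing

/-- The data of a left bialgebroid: an `Rᵉ`-ring with a coproduct `E → E ⊗_R E` and a counit.
The axioms are in `IsLeftBialgebroid`. -/
structure BialgebroidData (k R E : Type*) [CommRing k] [Ring R] [Algebra k R] [Ring E]
    [Algebra k E] extends EnvRing k R E where
  comul : E →ₗ[k] toEnvRing.Tensor toEnvRing.lact
  counit : E →ₗ[k] R

namespace BialgebroidData

variable {k R E M : Type*} [CommRing k] [Ring R] [Algebra k R] [Ring E] [Algebra k E]
  [AddCommGroup M] [Module k M] (D : BialgebroidData k R E)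

/-- `Δ ⊗ id`, as a map `E ⊗[k] M → E ⊗_R (E ⊗_R M)`. -/
noncomputable def comulTensor (la : R →ₐ[k] Module.End k M) :
    E ⊗[k] M →ₗ[k] D.Tensor (D.tensorAct la) :=
  TensorProduct.lift (LinearMap.mk₂ k (fun h m => D.assocAt la m (D.comul h))
    (fun _ _ _ => by simp) (fun _ _ _ => by simp)
    (fun h m m' => by
      refine LinearMap.congr_fun (g := D.assocAt la m + D.assocAt la m') ?_ (D.comul h)
      refine Submodule.linearMap_qext _ (TensorProduct.ext' fun x y => ?_)
      simp [EnvRing.assocAt, BalTensor.map, TensorProduct.tmul_add]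
      rfl)
    (fun c h m => by
      refine LinearMap.congr_fun (g := c • D.assocAt la m) ?_ (D.comul h)
      refine Submodule.linearMap_qext _ (TensorProduct.ext' fun x y => ?_)
      simp [EnvRing.assocAt, BalTensor.map]
      rfl))

/-- The map `E ⊗[k] M → M`, `h ⊗ m ↦ ε(h ◂ r) m`, where `h ◂ r = h s(r)`. -/
noncomputable def contract (la : R →ₐ[k] Module.End k M) (r : R) : E ⊗[k] M →ₗ[k] M :=
  TensorProduct.lift (la.toLinearMap ∘ₗ D.counit ∘ₗ LinearMap.mulRight k (D.source r))

/-- `(M, lam)` is a left comodule: the coaction `lam : M → E ⊗_R M` is left `R`-linear,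
coassociative and counital. Here, as below, an identity in Sweedler notation is stated
for all representatives `z ∈ E ⊗[k] M` of the coaction or coproduct in question. -/
structure IsLeftComodule (la : R →ₐ[k] Module.End k M) (lam : M →ₗ[k] D.Tensor la) : Prop where
  map_lact : ∀ r m, lam (la r m) = D.tensorAct la r (lam m)
  coassoc : ∀ (m : M) (z : E ⊗[k] M), D.tmk la z = lam m →
    D.tmk (D.tensorAct la) (LinearMap.lTensor E lam z) = D.comulTensor la z
  counit : ∀ (m : M) (z : E ⊗[k] M), D.tmk la z = lam m → D.contract la 1 z = m

/-- The axioms of a left bialgebroid over `R`. -/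
structure IsLeftBialgebroid : Prop where
  /-- left `R`-linearity, coassociativity and left counitality of the coproduct -/
  comodule : D.IsLeftComodule D.lact D.comul
  /-- `Δ(h ◃ r) = h₁ ⊗ (h₂ ◃ r)` -/
  comul_ract : ∀ (r : R) (h : E) (z : E ⊗[k] E), D.tmk D.lact z = D.comul h →
    D.comul (D.target (op r) * h) = D.tmk D.lact ((1 ⊗ₜ[k] D.target (op r)) * z)
  /-- `h₁ ◃ ε(h₂) = h` -/
  counit_right : ∀ (h : E) (z : E ⊗[k] E), D.tmk D.lact z = D.comul h →
    TensorProduct.lift ((LinearMap.mul k E).flip.compl₂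
      (D.target.toLinearMap ∘ₗ (opLinearEquiv k).toLinearMap ∘ₗ D.counit)) z = h
  /-- the coproduct has values in the Takeuchi subspace: `h₁ t(r) ⊗ h₂ = h₁ ⊗ h₂ s(r)` -/
  takeuchi : ∀ (r : R) (h : E) (z : E ⊗[k] E), D.tmk D.lact z = D.comul h →
    D.tmk D.lact (z * (D.target (op r) ⊗ₜ[k] 1)) = D.tmk D.lact (z * (1 ⊗ₜ[k] D.source r))
  comul_one : D.comul 1 = D.tmk D.lact (1 ⊗ₜ[k] 1)
  comul_mul : ∀ (h h' : E) (z z' : E ⊗[k] E), D.tmk D.lact z = D.comul h →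
    D.tmk D.lact z' = D.comul h' → D.comul (h * h') = D.tmk D.lact (z * z')
  counit_one : D.counit 1 = 1
  counit_bilinear : ∀ (r r' : R) (h : E),
    D.counit (D.source r * D.target (op r') * h) = r * D.counit h * r'
  counit_mul_source : ∀ h h' : E, D.counit (h * h') = D.counit (h * D.source (D.counit h'))
  counit_mul_target : ∀ h h' : E, D.counit (h * h') = D.counit (h * D.target (op (D.counit h')))

/-- A left bialgebroid is a right Hopf algebroid if `h ⊗ h' ↦ h₁ h' ⊗ h₂` is a (well defined)
bijection from `E ⊗_R E`, balanced by `h s(r) ⊗ h' = h ⊗ s(r) h'`, to `E ⊗_R E`, balanced by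
`t(r) h ⊗ h' = h ⊗ s(r) h'`. -/
def IsRightHopf : Prop :=
  ∃ α : BalTensor D.bract D.lact →ₗ[k] D.Tensor D.lact,
    (∀ (h h' : E) (z : E ⊗[k] E), D.tmk D.lact z = D.comul h →
      α (BalTensor.mk D.bract D.lact (h ⊗ₜ[k] h')) = D.tmk D.lact (z * (h' ⊗ₜ[k] 1))) ∧
    Function.Bijective α

/-! ### Covariant bimodules and first order differential calculi

`L : E →ₐ[k] Module.End k Ω` and `Rt : Eᵐᵒᵖ →ₐ[k] Module.End k Ω` are the left and the right
`E`-action on `Ω`: `h ω = L h ω` and `ω h = Rt (op h) ω`. -/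

variable {Ω : Type*} [AddCommGroup Ω] [Module k Ω]

/-- First order differential calculus on a left bialgebroid. -/
structure IsCalculus (L : E →ₐ[k] Module.End k Ω) (Rt : Eᵐᵒᵖ →ₐ[k] Module.End k Ω)
    (d : E →ₗ[k] Ω) : Prop where
  bimodule : ∀ h h' ω, L h (Rt (op h') ω) = Rt (op h') (L h ω)
  /-- `d(s(r) h s(r')) = s(r) d(h) s(r')` -/
  map_source : ∀ r r' h, d (D.source r * h * D.source r') =
    L (D.source r) (Rt (op (D.source r')) (d h))
  leibniz : ∀ h h', d (h * h') = Rt (op h') (d h) + L h (d h')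
  surjective : Submodule.span k {ω | ∃ h h' : E, ω = L h (d h')} = ⊤

/-- The natural left `R`-action `r ω = s(r) ω` on a left `E`-module. -/
noncomputable def resAct (L : E →ₐ[k] Module.End k Ω) : R →ₐ[k] Module.End k Ω :=
  L.comp D.source

/-- The product `(x ⊗ y)(g ⊗ ω) = x g ⊗ y ω`. -/
noncomputable def diagLeft (L : E →ₐ[k] Module.End k Ω) :
    E ⊗[k] E →ₗ[k] E ⊗[k] Ω →ₗ[k] E ⊗[k] Ω :=
  TensorProduct.map₂ (LinearMap.mul k E) L.toLinearMap

/-- The product `(g ⊗ ω)(x ⊗ y) = g x ⊗ ω y`, with its second argument first. -/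
noncomputable def diagRight (Rt : Eᵐᵒᵖ →ₐ[k] Module.End k Ω) :
    E ⊗[k] E →ₗ[k] E ⊗[k] Ω →ₗ[k] E ⊗[k] Ω :=
  TensorProduct.map₂ (LinearMap.mul k E).flip (Rt.toLinearMap ∘ₗ (opLinearEquiv k).toLinearMap)

/-- Left covariant bimodule: an `E`-bimodule and left `E`-comodule `Ω` whose natural left and
induced right `R`-action `ω r = ε(ω₍₋₁₎ s(r)) ω₍₀₎` are given by the source map and the two
`E`-actions, and whose coaction has values in the Takeuchi subspace and satisfies
`λ(h ω) = Δ(h) λ(ω)` and `λ(ω h) = λ(ω) Δ(h)`. -/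
structure IsLeftCovariantBimodule (L : E →ₐ[k] Module.End k Ω)
    (Rt : Eᵐᵒᵖ →ₐ[k] Module.End k Ω) (lam : Ω →ₗ[k] D.Tensor (D.resAct L)) : Prop where
  bimodule : ∀ h h' ω, L h (Rt (op h') ω) = Rt (op h') (L h ω)
  comodule : D.IsLeftComodule (D.resAct L) lam
  induced_right : ∀ (r : R) (ω : Ω) (z : E ⊗[k] Ω), D.tmk (D.resAct L) z = lam ω →
    D.contract (D.resAct L) r z = Rt (op (D.source r)) ω
  takeuchi : ∀ (r : R) (ω : Ω) (z : E ⊗[k] Ω), D.tmk (D.resAct L) z = lam ω →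
    D.tmk (D.resAct L) (diagRight Rt (D.target (op r) ⊗ₜ[k] 1) z) =
      D.tmk (D.resAct L) (diagRight Rt (1 ⊗ₜ[k] D.source r) z)
  left_compat : ∀ (h : E) (ω : Ω) (z : E ⊗[k] E) (w : E ⊗[k] Ω), D.tmk D.lact z = D.comul h →
    D.tmk (D.resAct L) w = lam ω → lam (L h ω) = D.tmk (D.resAct L) (diagLeft L z w)
  right_compat : ∀ (h : E) (ω : Ω) (z : E ⊗[k] E) (w : E ⊗[k] Ω), D.tmk D.lact z = D.comul h →
    D.tmk (D.resAct L) w = lam ω → lam (Rt (op h) ω) = D.tmk (D.resAct L) (diagRight Rt z w)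

/-- Left covariant first order differential calculus on a left bialgebroid; the last condition
is `λ ∘ d = (id ⊗ d) ∘ Δ`. -/
structure IsLeftCovariantCalculus (L : E →ₐ[k] Module.End k Ω)
    (Rt : Eᵐᵒᵖ →ₐ[k] Module.End k Ω) (lam : Ω →ₗ[k] D.Tensor (D.resAct L))
    (d : E →ₗ[k] Ω) : Prop where
  calculus : D.IsCalculus L Rt d
  covariant : D.IsLeftCovariantBimodule L Rt lam
  colinear : ∀ (h : E) (z : E ⊗[k] E), D.tmk D.lact z = D.comul h →
    lam (d h) = D.tmk (D.resAct L) (LinearMap.lTensor E d z)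

/-! ### The forms `E ⊗_R (P / I)` for left ideals `I ⊆ P` -/

/-- The action of `E` on an `E`-module as an algebra morphism. -/
noncomputable abbrev smulHom (k : Type*) [CommRing k] (E : Type*) [Ring E] [Algebra k E]
    (Q : Type*) [AddCommGroup Q] [Module k Q] [Module E Q] [IsScalarTower k E Q] :
    E →ₐ[k] Module.End k Q :=
  Algebra.lsmul k k Q

/-- The left `E`-module `P / I` for left ideals `I ⊆ P` of `E`. -/
abbrev IdealQuot (P I : Ideal E) := ↥P ⧸ Submodule.comap P.subtype I

/-- `E ⊗_R P` for a left ideal `P`, with `R` acting on `P` by the source map. -/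
abbrev TensorIdeal (P : Ideal E) := D.Tensor (D.resAct (smulHom k E P))

/-- `E ⊗_R (P / I)`, with `R` acting on `P / I` by the source map. -/
abbrev Forms (P I : Ideal E) := D.Tensor (D.resAct (smulHom k E (IdealQuot P I)))

/-- The map `E ⊗_R P → E ⊗_R E` given by the inclusion. -/
noncomputable def tensorIncl (P : Ideal E) : D.TensorIdeal P →ₗ[k] D.Tensor D.lact :=
  BalTensor.map LinearMap.id (P.subtype.restrictScalars k) (fun _ _ => rfl) (fun _ _ => rfl)

/-- The map `E ⊗_R P → E ⊗_R (P / I)` given by the projection. -/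
noncomputable def tensorProj (P I : Ideal E) : D.TensorIdeal P →ₗ[k] D.Forms P I :=
  BalTensor.map LinearMap.id ((Submodule.comap P.subtype I).mkQ.restrictScalars k)
    (fun _ _ => rfl) (fun _ _ => rfl)

/-- `d` is the differential induced by the coproduct: `Δ(x) - x ⊗ 1` comes from `E ⊗_R P`, and
`d x` is its image under `id ⊗ π : E ⊗_R P → E ⊗_R (P / I)`. -/
def IsInducedDifferential (P I : Ideal E) (d : E →ₗ[k] D.Forms P I) : Prop :=
  ∀ x : E,
    (∃ w : D.TensorIdeal P, D.tensorIncl P w = D.comul x - D.tmk D.lact (x ⊗ₜ[k] 1)) ∧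
    ∀ w : D.TensorIdeal P, D.tensorIncl P w = D.comul x - D.tmk D.lact (x ⊗ₜ[k] 1) →
      d x = D.tensorProj P I w

/-- The structure of `E ⊗_R (P / I)` is the standard one: `h (g ⊗ q) = h₁ g ⊗ h₂ q`,
`(g ⊗ q) h = g h ⊗ q` and `λ(g ⊗ q) = g₁ ⊗ (g₂ ⊗ q)`. -/
structure IsStandardStructure (P I : Ideal E) (L : E →ₐ[k] Module.End k (D.Forms P I))
    (Rt : Eᵐᵒᵖ →ₐ[k] Module.End k (D.Forms P I))
    (lam : D.Forms P I →ₗ[k] D.Tensor (D.resAct L)) : Prop where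
  left_act : ∀ (h g : E) (q : IdealQuot P I) (z : E ⊗[k] E), D.tmk D.lact z = D.comul h →
    L h (D.tmk _ (g ⊗ₜ[k] q)) = D.tmk _ (diagLeft (smulHom k E (IdealQuot P I)) z (g ⊗ₜ[k] q))
  right_act : ∀ (h g : E) (q : IdealQuot P I),
    Rt (op h) (D.tmk _ (g ⊗ₜ[k] q)) = D.tmk _ ((g * h) ⊗ₜ[k] q)
  coact : ∀ (g : E) (q : IdealQuot P I) (z : E ⊗[k] E), D.tmk D.lact z = D.comul g →
    lam (D.tmk _ (g ⊗ₜ[k] q)) = D.tmk (D.resAct L)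
      (LinearMap.lTensor E (D.tmk (D.resAct (smulHom k E (IdealQuot P I))) ∘ₗ
        (TensorProduct.mk k E (IdealQuot P I)).flip q) z)

end BialgebroidData

/-! ### Yetter-Drinfel'd modules and braided commutative algebras -/

/-- A left-right Yetter-Drinfel'd module over a bialgebra `H`: a left `H`-module and right
`H`-comodule with `h₁ m₀ ⊗ h₂ m₁ = (h₂ m)₀ ⊗ (h₂ m)₁ h₁`. -/
structure YetterDrinfeld (k H M : Type*) [CommRing k] [Ring H] [Bialgebra k H] [AddCommGroup M]
    [Module k M] where
  act : H →ₐ[k] Module.End k M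
  coact : M →ₗ[k] M ⊗[k] H
  coassoc : ∀ m, TensorProduct.assoc k M H H (LinearMap.rTensor H coact (coact m)) =
    LinearMap.lTensor M Coalgebra.comul (coact m)
  counit : ∀ m, LinearMap.lTensor M Coalgebra.counit (coact m) = m ⊗ₜ[k] (1 : k)
  compat : ∀ (h : H) (m : M),
    TensorProduct.map₂ act.toLinearMap (LinearMap.mul k H) (Coalgebra.comul h) (coact m) =
      TensorProduct.lift
        ((LinearMap.lTensorHom M ∘ₗ (LinearMap.mul k H).flip).compl₂
          (coact ∘ₗ act.toLinearMap.flip m))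
        (Coalgebra.comul (R := k) h)

/-- A braided commutative algebra in the category of left-right Yetter-Drinfel'd modules:
multiplication and unit are `H`-linear and `H`-colinear, and `b₀ (b₁ · a) = a b`. On `M ⊗ N`
the action is `h (m ⊗ n) = h₁ m ⊗ h₂ n` and the coaction is `m ⊗ n ↦ m₀ ⊗ n₀ ⊗ n₁ m₁`. -/
structure BraidedCommAlgebra (k H A : Type*) [CommRing k] [Ring H] [Bialgebra k H] [Ring A]
    [Algebra k A] extends YetterDrinfeld k H A where
  act_mul : ∀ (h : H) (a b : A), act h (a * b) =
    LinearMap.mul' k A (TensorProduct.map₂ act.toLinearMap act.toLinearMap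
      (Coalgebra.comul h) (a ⊗ₜ[k] b))
  act_one : ∀ h : H, act h 1 = algebraMap k A (Coalgebra.counit h)
  coact_mul : ∀ a b : A, coact (a * b) =
    TensorProduct.map₂ (LinearMap.mul k A) (LinearMap.mul k H).flip (coact a) (coact b)
  coact_one : coact 1 = 1 ⊗ₜ[k] 1
  braided_comm : ∀ a b : A,
    TensorProduct.lift ((LinearMap.mul k A).compl₂ (act.toLinearMap.flip a)) (coact b) = a * b

namespace BraidedCommAlgebra

variable {k H A : Type*} [CommRing k] [Ring H] [Bialgebra k H] [Ring A] [Algebra k A]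

/-- The smash product `A # H`, with underlying `k`-module `A ⊗ H`. -/
def Smash (_Y : BraidedCommAlgebra k H A) : Type _ := A ⊗[k] H

variable (Y : BraidedCommAlgebra k H A)

instance : AddCommGroup Y.Smash := inferInstanceAs (AddCommGroup (A ⊗[k] H))

instance : Module k Y.Smash := inferInstanceAs (Module k (A ⊗[k] H))

/-- The identification of `A ⊗ H` with `A # H`. -/
def ofTensor : A ⊗[k] H ≃ₗ[k] Y.Smash := LinearEquiv.refl k _

/-- The diagonal action `h (b ⊗ g) = h₁ · b ⊗ h₂ g` of `H` on `A ⊗ H`. -/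
noncomputable def diag : H →ₗ[k] Module.End k (A ⊗[k] H) :=
  TensorProduct.map₂ Y.act.toLinearMap (LinearMap.mul k H) ∘ₗ Coalgebra.comul

/-- The action `a (b ⊗ g) = a b ⊗ g` of `A` on `A ⊗ H`. -/
noncomputable def leftMul : A →ₗ[k] Module.End k (A ⊗[k] H) :=
  LinearMap.rTensorHom H ∘ₗ LinearMap.mul k A

/-- The product `(a # h)(b # g) = a (h₁ · b) # h₂ g`. -/
noncomputable def smashMul : A ⊗[k] H →ₗ[k] Module.End k (A ⊗[k] H) :=
  TensorProduct.lift ((LinearMap.mul k (Module.End k (A ⊗[k] H))).compl₁₂ leftMul Y.diag)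

theorem leftMul_tmul (a b : A) (g : H) :
    (leftMul (k := k) a) (b ⊗ₜ[k] g) = (a * b) ⊗ₜ[k] g := rfl

theorem smashMul_tmul (a : A) (h : H) :
    Y.smashMul (a ⊗ₜ[k] h) = leftMul a * Y.diag h := rfl

theorem diag_tmul (h : H) (b : A) (g : H) : Y.diag h (b ⊗ₜ[k] g) =
    TensorProduct.map (Y.act.toLinearMap.flip b) (LinearMap.mulRight k g)
      (Coalgebra.comul (R := k) h) := by
  have key : ∀ z : H ⊗[k] H,
      TensorProduct.map₂ Y.act.toLinearMap (LinearMap.mul k H) z (b ⊗ₜ[k] g) =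
      TensorProduct.map (Y.act.toLinearMap.flip b) (LinearMap.mulRight k g) z := by
    intro z
    induction z with
    | zero => simp
    | add x y hx hy => simp only [map_add, LinearMap.add_apply, hx, hy]
    | tmul x y => rfl
  exact key _

theorem diag_mul (h h' : H) : Y.diag (h * h') = Y.diag h * Y.diag h' := by
  have key : ∀ z z' : H ⊗[k] H,
      TensorProduct.map₂ Y.act.toLinearMap (LinearMap.mul k H) (z * z') =
      (TensorProduct.map₂ Y.act.toLinearMap (LinearMap.mul k H) z : Module.End k (A ⊗[k] H)) *
      (TensorProduct.map₂ Y.act.toLinearMap (LinearMap.mul k H) z' : Module.End k (A ⊗[k] H)) := by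
    intro z z'
    induction z with
    | zero => simp
    | add x y hx hy => simp only [add_mul, map_add, hx, hy]
    | tmul x y =>
      induction z' with
      | zero => simp
      | add x' y' hx hy => simp only [mul_add, map_add, hx, hy]
      | tmul x' y' =>
        refine TensorProduct.ext' fun b g => ?_
        simp [TensorProduct.map₂_apply_tmul, mul_assoc]
  simp [diag, Bialgebra.comul_mul, key]

theorem diag_one : Y.diag 1 = 1 := by
  refine TensorProduct.ext' fun b g => ?_
  simp [diag, Bialgebra.comul_one, Algebra.TensorProduct.one_def, TensorProduct.map₂_apply_tmul]

theorem diag_leftMul (h : H) (b : A) :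
    Y.diag h * leftMul b = TensorProduct.lift
      ((LinearMap.mul k (Module.End k (A ⊗[k] H))).compl₁₂
        (leftMul ∘ₗ Y.act.toLinearMap.flip b) Y.diag) (Coalgebra.comul (R := k) h) := by
  refine TensorProduct.ext' fun c l => ?_
  let F : H ⊗[k] (H ⊗[k] H) →ₗ[k] A ⊗[k] H :=
    TensorProduct.lift ((leftMul ∘ₗ Y.act.toLinearMap.flip b).compl₂
      (TensorProduct.map (Y.act.toLinearMap.flip c) (LinearMap.mulRight k l)))
  have h1 : ∀ z : H ⊗[k] H, F (LinearMap.lTensor H Coalgebra.comul z) =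
      TensorProduct.lift ((LinearMap.mul k (Module.End k (A ⊗[k] H))).compl₁₂
        (leftMul ∘ₗ Y.act.toLinearMap.flip b) Y.diag) z (c ⊗ₜ[k] l) := by
    intro z
    induction z with
    | zero => simp
    | add x y hx hy => simp only [map_add, LinearMap.add_apply, hx, hy]
    | tmul x y => simp [F, Module.End.mul_apply, diag_tmul]
  have h2 : ∀ (u : H ⊗[k] H) (y : H), F (TensorProduct.assoc k H H H (u ⊗ₜ[k] y)) =
      LinearMap.mul' k A (TensorProduct.map₂ Y.act.toLinearMap Y.act.toLinearMap u
        (b ⊗ₜ[k] c)) ⊗ₜ[k] (y * l) := by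
    intro u y
    induction u with
    | zero => simp
    | add p q hp hq =>
      simp only [map_add, LinearMap.add_apply, TensorProduct.add_tmul, hp, hq]
    | tmul p q => rfl
  have h3 : ∀ z : H ⊗[k] H, F (TensorProduct.assoc k H H H (LinearMap.rTensor H Coalgebra.comul z))
      = TensorProduct.map (Y.act.toLinearMap.flip (b * c)) (LinearMap.mulRight k l) z := by
    intro z
    induction z with
    | zero => simp
    | add x y hx hy => simp only [map_add, hx, hy]
    | tmul x y => rw [LinearMap.rTensor_tmul, h2, ← Y.act_mul]; rfl
  rw [Module.End.mul_apply, leftMul_tmul, diag_tmul, ← h3, Coalgebra.coassoc_apply, h1]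

theorem smashMul_leftMul (a : A) (w : A ⊗[k] H) :
    Y.smashMul (leftMul a w) = leftMul a * Y.smashMul w := by
  induction w with
  | zero => simp
  | add x y hx hy => simp only [map_add, mul_add, hx, hy]
  | tmul b g =>
    refine TensorProduct.ext' fun c l => ?_
    rw [leftMul_tmul, smashMul_tmul, smashMul_tmul, ← mul_assoc]
    have : leftMul (k := k) (H := H) (a * b) = leftMul a * leftMul b :=
      TensorProduct.ext' fun c l => by simp [leftMul_tmul, mul_assoc]
    rw [this]

theorem smashMul_diag (h : H) (w : A ⊗[k] H) :
    Y.smashMul (Y.diag h w) = Y.diag h * Y.smashMul w := by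
  induction w with
  | zero => simp
  | add x y hx hy => simp only [map_add, mul_add, hx, hy]
  | tmul b g =>
    rw [smashMul_tmul, ← mul_assoc, diag_leftMul, diag_tmul]
    generalize (Coalgebra.comul (R := k) h) = z
    induction z with
    | zero => simp
    | add x y hx hy => simp only [map_add, add_mul, hx, hy]
    | tmul x y => simp [smashMul_tmul, diag_mul, mul_assoc]

theorem smashMul_smashMul (x y : A ⊗[k] H) :
    Y.smashMul (Y.smashMul x y) = Y.smashMul x * Y.smashMul y := by
  induction x with
  | zero => simp
  | add x x' hx hy => simp only [map_add, LinearMap.add_apply, add_mul, hx, hy]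
  | tmul a h =>
    rw [smashMul_tmul, Module.End.mul_apply, smashMul_leftMul, smashMul_diag, mul_assoc]

theorem smashMul_one_left : Y.smashMul (1 ⊗ₜ[k] 1) = 1 := by
  rw [smashMul_tmul, diag_one, mul_one]
  exact TensorProduct.ext' fun c l => by simp [leftMul_tmul]

theorem smashMul_one_right (x : A ⊗[k] H) : Y.smashMul x (1 ⊗ₜ[k] 1) = x := by
  induction x with
  | zero => simp
  | add x x' hx hy => simp only [map_add, LinearMap.add_apply, hx, hy]
  | tmul a h =>
    have key : ∀ z : H ⊗[k] H,
        TensorProduct.map (Y.act.toLinearMap.flip 1) (LinearMap.mulRight k (1 : H)) z =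
        LinearMap.rTensor H (Algebra.linearMap k A)
          (LinearMap.rTensor H Coalgebra.counit z) := by
      intro z
      induction z with
      | zero => simp
      | add x y hx hy => simp only [map_add, hx, hy]
      | tmul x y => simp [Y.act_one]
    rw [smashMul_tmul, Module.End.mul_apply, diag_tmul, key, Coalgebra.rTensor_counit_comul]
    simp [leftMul_tmul]

theorem smashMul_coact (a c : A) (l : H) : Y.smashMul (Y.coact a) (c ⊗ₜ[k] l) =
    TensorProduct.map (LinearMap.mulLeft k c) (LinearMap.mulRight k l) (Y.coact a) := by
  let G : A ⊗[k] (H ⊗[k] H) →ₗ[k] A ⊗[k] H :=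
    TensorProduct.lift (leftMul.compl₂
      (TensorProduct.map (Y.act.toLinearMap.flip c) (LinearMap.mulRight k l)))
  have h1 : ∀ z : A ⊗[k] H, Y.smashMul z (c ⊗ₜ[k] l) =
      G (LinearMap.lTensor A Coalgebra.comul z) := by
    intro z
    induction z with
    | zero => simp
    | add x y hx hy => simp only [map_add, LinearMap.add_apply, hx, hy]
    | tmul x y => simp [G, smashMul_tmul, Module.End.mul_apply, diag_tmul]
  have h2 : ∀ (u : A ⊗[k] H) (y : H), G (TensorProduct.assoc k A H H (u ⊗ₜ[k] y)) =
      TensorProduct.lift ((LinearMap.mul k A).compl₂ (Y.act.toLinearMap.flip c)) u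
        ⊗ₜ[k] (y * l) := by
    intro u y
    induction u with
    | zero => simp
    | add p q hp hq =>
      simp only [map_add, TensorProduct.add_tmul, hp, hq]
    | tmul p q => rfl
  rw [h1, ← Y.coassoc]
  generalize Y.coact a = z
  induction z with
  | zero => simp
  | add x y hx hy => simp only [map_add, hx, hy]
  | tmul x y => rw [LinearMap.rTensor_tmul, h2, Y.braided_comm]; rfl

theorem smashMul_coact_coact (a b : A) :
    Y.smashMul (Y.coact a) (Y.coact b) = Y.coact (b * a) := by
  rw [Y.coact_mul]
  generalize Y.coact b = z
  induction z with
  | zero => simp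
  | add x y hx hy => simp only [map_add, LinearMap.add_apply, hx, hy]
  | tmul x y =>
    rw [smashMul_coact]
    generalize Y.coact a = w
    induction w with
    | zero => simp
    | add x y hx hy => simp only [map_add, hx, hy]
    | tmul p q => rfl

noncomputable instance : Ring Y.Smash :=
  { (inferInstance : AddCommGroup Y.Smash) with
    mul := fun x y => Y.smashMul x y
    one := Y.ofTensor (1 ⊗ₜ[k] 1)
    left_distrib := fun x y z => (Y.smashMul x).map_add y z
    right_distrib := fun x y z => LinearMap.congr_fun (Y.smashMul.map_add x y) z
    zero_mul := fun x => LinearMap.congr_fun Y.smashMul.map_zero x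
    mul_zero := fun x => (Y.smashMul x).map_zero
    mul_assoc := fun x y z => LinearMap.congr_fun (Y.smashMul_smashMul x y) z
    one_mul := fun x => LinearMap.congr_fun Y.smashMul_one_left x
    mul_one := fun x => Y.smashMul_one_right x }

noncomputable instance : Algebra k Y.Smash :=
  Algebra.ofModule (fun c x y => LinearMap.congr_fun (Y.smashMul.map_smul c x) y)
    (fun c x y => (Y.smashMul x).map_smul c y)

theorem smash_mul_def (x y : Y.Smash) : x * y = Y.smashMul x y := rfl

/-- The `Aᵉ`-ring `A # H`, with `s(a) = a # 1` and `t(a) = a₀ # a₁`. -/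
noncomputable def envRing : EnvRing k A Y.Smash where
  source := AlgHom.ofLinearMap (Y.ofTensor.toLinearMap ∘ₗ (TensorProduct.mk k A H).flip 1) rfl
    (fun a b => by
      change (a * b) ⊗ₜ[k] (1 : H) = Y.smashMul (a ⊗ₜ[k] 1) (b ⊗ₜ[k] 1)
      rw [smashMul_tmul, diag_one]; rfl)
  target := AlgHom.ofLinearMap
    (Y.ofTensor.toLinearMap ∘ₗ Y.coact ∘ₗ (opLinearEquiv k).symm.toLinearMap)
    Y.coact_one (fun a b => (Y.smashMul_coact_coact a.unop b.unop).symm)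
  commute := fun a b => by
    change Y.smashMul (a ⊗ₜ[k] 1) (Y.coact b.unop) = Y.smashMul (Y.coact b.unop) (a ⊗ₜ[k] 1)
    rw [smashMul_coact, smashMul_tmul, diag_one, mul_one, LinearMap.mulRight_one]
    rfl

/-- The scalar extension bialgebroid `A # H` over `A`, with
`Δ(a # h) = (a # h₁) ⊗ (1 # h₂)` and `ε(a # h) = ε(h) a`. -/
noncomputable def scalarExtension : BialgebroidData k A Y.Smash where
  toEnvRing := Y.envRing
  comul := Y.envRing.tmk Y.envRing.lact ∘ₗ
    TensorProduct.map Y.ofTensor.toLinearMap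
      (Y.ofTensor.toLinearMap ∘ₗ TensorProduct.mk k A H 1) ∘ₗ
    (TensorProduct.assoc k A H H).symm.toLinearMap ∘ₗ
    LinearMap.lTensor A Coalgebra.comul ∘ₗ Y.ofTensor.symm.toLinearMap
  counit := (TensorProduct.rid k A).toLinearMap ∘ₗ LinearMap.lTensor A Coalgebra.counit ∘ₗ
    Y.ofTensor.symm.toLinearMap

theorem counit_smashMul (x y : A ⊗[k] H)
    (hy : TensorProduct.rid k A (LinearMap.lTensor A Coalgebra.counit y) = 0) :
    TensorProduct.rid k A (LinearMap.lTensor A Coalgebra.counit (Y.smashMul x y)) = 0 := by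
  have key : ∀ (z : H ⊗[k] H) (b : A) (g : H),
      TensorProduct.rid k A (LinearMap.lTensor A Coalgebra.counit
        (TensorProduct.map (Y.act.toLinearMap.flip b) (LinearMap.mulRight k g) z)) =
      Y.act (TensorProduct.rid k H (LinearMap.lTensor H Coalgebra.counit z))
        (TensorProduct.rid k A (LinearMap.lTensor A Coalgebra.counit (b ⊗ₜ[k] g))) := by
    intro z b g
    induction z with
    | zero => simp
    | add x y hx hy => simp only [map_add, LinearMap.add_apply, hx, hy]
    | tmul x y => simpa [mul_smul] using smul_comm _ _ _
  have key' : ∀ (a : A) (h : H) (y : A ⊗[k] H),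
      TensorProduct.rid k A (LinearMap.lTensor A Coalgebra.counit (Y.smashMul (a ⊗ₜ[k] h) y)) =
      a * Y.act h (TensorProduct.rid k A (LinearMap.lTensor A Coalgebra.counit y)) := by
    intro a h y
    induction y with
    | zero => simp
    | add x y hx hy => simp only [map_add, mul_add, hx, hy]
    | tmul b g =>
      have := key (Coalgebra.comul (R := k) h) b g
      rw [Coalgebra.lTensor_counit_comul, ← diag_tmul] at this
      simp only [TensorProduct.rid_tmul, one_smul] at this
      rw [← this, smashMul_tmul, Module.End.mul_apply]
      generalize Y.diag h (b ⊗ₜ[k] g) = w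
      induction w with
      | zero => simp
      | add x y hx hy => simp only [map_add, mul_add, hx, hy]
      | tmul p q => simp [leftMul_tmul]
  induction x with
  | zero => simp
  | add x x' h h' => simp only [map_add, LinearMap.add_apply, h, h', add_zero]
  | tmul a h => rw [key', hy]; simp

/-- The left ideal `(A # H)⁺ = ker ε` of `A # H`. -/
noncomputable def plus : Ideal Y.Smash where
  carrier := {x | Y.scalarExtension.counit x = 0}
  add_mem' := fun {x y} hx hy => by
    have hx' : Y.scalarExtension.counit x = 0 := hx
    have hy' : Y.scalarExtension.counit y = 0 := hy
    simp [hx', hy']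
  zero_mem' := by simp
  smul_mem' := fun x y hy => Y.counit_smashMul x y hy

/-- The subspace `I_A # I_H` of `A # H`, spanned by all `a # h` with `a ∈ I_A` and `h ∈ I_H`. -/
def smashSub (IA : Ideal A) (IH : Ideal H) : Submodule k (A ⊗[k] H) :=
  Submodule.span k {x | ∃ a ∈ IA, ∃ h ∈ IH, x = a ⊗ₜ[k] h}

theorem smashMul_mem (IA : Ideal A) (IH : Ideal H) (hIA : ∀ (h : H), ∀ a ∈ IA, Y.act h a ∈ IA)
    (x y : A ⊗[k] H) (hy : y ∈ smashSub (k := k) IA IH) :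
    Y.smashMul x y ∈ smashSub (k := k) IA IH := by
  induction hy using Submodule.span_induction with
  | zero => simp
  | add y y' _ _ h h' => rw [map_add]; exact add_mem h h'
  | smul c y _ h => rw [map_smul]; exact Submodule.smul_mem _ c h
  | mem y hy =>
    obtain ⟨b, hb, g, hg, rfl⟩ := hy
    induction x with
    | zero => simp
    | add x x' h h' => rw [map_add]; exact add_mem h h'
    | tmul a h =>
      rw [smashMul_tmul, Module.End.mul_apply, diag_tmul]
      generalize Coalgebra.comul (R := k) h = z
      induction z with
      | zero => simp
      | add p q hp hq => rw [map_add, map_add]; exact add_mem hp hq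
      | tmul p q =>
        exact Submodule.subset_span
          ⟨a * Y.act p b, IA.mul_mem_left a (hIA p b hb), q * g, IH.mul_mem_left q hg, rfl⟩

/-- `I_A # I_H` as a left ideal of `A # H`, if `I_A` is closed under the action of `H`. -/
noncomputable def smashIdeal (IA : Ideal A) (IH : Ideal H)
    (hIA : ∀ (h : H), ∀ a ∈ IA, Y.act h a ∈ IA) : Ideal Y.Smash where
  carrier := {x | Y.ofTensor.symm x ∈ smashSub (k := k) IA IH}
  add_mem' := fun hx hy => (smashSub (k := k) IA IH).add_mem hx hy
  zero_mem' := (smashSub (k := k) IA IH).zero_mem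
  smul_mem' := fun x y hy => Y.smashMul_mem IA IH hIA x y hy

end BraidedCommAlgebra

/-! The argument separates a construction valid for every left bialgebroid `E` over `R` from the
verification that `A # H` is a right Hopf algebroid.

For any left `E`-module `Q`, the space `E ⊗_R Q` is a left covariant bimodule under the diagonal
left action, right multiplication on the first factor, and the coproduct on the first factor
(`isLeftCovariantBimodule`). The Takeuchi condition makes the diagonal action well defined. The maps
`g ↦ g ⊗ q` are colinear and their images span, so most comodule axioms are transported from `E`;
compatibility with the left action is coassociativity of `Δ`.

Now let `p : E → Q` be left `R`-linear with `p(xy) = x p(y) + p(x s(ε(y)))`, and put `d = (id ⊗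
p)Δ`. In `d(hh') = h₁h'₁ ⊗ p(h₂h'₂)` the first summand of `p` gives `h d(h')`. In the second, the
Takeuchi condition turns `s(ε(h'₂))` in the second leg into `t(ε(h'₂))` between `h₁` and `h'₁`, and
the right counit law contracts this to `d(h)h'` (`tensorMap_comul_mul`). Thus `d(h)h' = d(hh') - h
d(h')` lies in the span of the forms `x dy`; since `d(h)h'` is `id ⊗ p` applied to the Galois map at
`h ⊗ h'`, surjectivity of that map and of `p` shows that these forms span (`span_tensorMap_comul`).
The calculus of the theorem is the case of `p(x) = [x - s(ε(x))]` in `ker ε / I`, where the identity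
for `p` amounts to `ε(xy) = ε(x s(ε(y)))`.

For `A # H`, the representatives `(a # h₁) ⊗ (1 # h₂)` of the coproduct are already multiplicative
before balancing (`comulRep_mul`). Coassociativity of the coaction governs `Δ(t(r)x)`, and the
Yetter-Drinfel'd condition, read as `(a # h) t(r) = t(h₂·r)(a # h₁)`, gives the Takeuchi condition
(`smk_mul_target`, `comul_takeuchi`). The inverse of the Galois map is `y ⊗ (b # g) ↦ (1 # g₂) ⊗ (1
# S⁻¹(g₁)) t(b) y`. -/

/-! ### Maps out of balanced tensor products -/

namespace BalTensor

variable {k R M N M' N' V : Type*} [CommRing k] [Ring R] [Algebra k R]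
  [AddCommGroup M] [Module k M] [AddCommGroup N] [Module k N]
  [AddCommGroup M'] [Module k M'] [AddCommGroup N'] [Module k N']
  [AddCommGroup V] [Module k V]
  {ra : Rᵐᵒᵖ →ₐ[k] Module.End k M} {la : R →ₐ[k] Module.End k N}
  {ra' : Rᵐᵒᵖ →ₐ[k] Module.End k M'} {la' : R →ₐ[k] Module.End k N'}

theorem mk_surjective (x : BalTensor ra la) : ∃ z, mk ra la z = x :=
  Submodule.mkQ_surjective _ x

theorem mk_balanced (r : R) (m : M) (n : N) :
    mk ra la (ra (op r) m ⊗ₜ[k] n) = mk ra la (m ⊗ₜ[k] la r n) :=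
  (Submodule.Quotient.eq _).2 (Submodule.subset_span ⟨r, m, n, rfl⟩)

theorem balancedRel_le_ker {F : M ⊗[k] N →ₗ[k] V}
    (hF : ∀ r m n, F (ra (op r) m ⊗ₜ[k] n) = F (m ⊗ₜ[k] la r n)) :
    balancedRel ra la ≤ LinearMap.ker F := by
  refine Submodule.span_le.2 ?_
  rintro _ ⟨r, m, n, rfl⟩
  simp [hF]

/-- A balanced bilinear map factors through the balanced tensor product. -/
def lift (F : M ⊗[k] N →ₗ[k] V)
    (hF : ∀ r m n, F (ra (op r) m ⊗ₜ[k] n) = F (m ⊗ₜ[k] la r n)) : BalTensor ra la →ₗ[k] V :=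
  (balancedRel ra la).liftQ F (balancedRel_le_ker hF)

@[simp] theorem lift_mk (F : M ⊗[k] N →ₗ[k] V)
    (hF : ∀ r m n, F (ra (op r) m ⊗ₜ[k] n) = F (m ⊗ₜ[k] la r n)) (z : M ⊗[k] N) :
    lift F hF (mk ra la z) = F z := rfl

/-- This makes Sweedler identities independent of representatives: once both sides are balanced, a
single representative decides them. -/
theorem eq_of_mk_eq (F : M ⊗[k] N →ₗ[k] V)
    (hF : ∀ r m n, F (ra (op r) m ⊗ₜ[k] n) = F (m ⊗ₜ[k] la r n)) {z z' : M ⊗[k] N}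
    (h : mk ra la z = mk ra la z') : F z = F z' := by
  rw [← lift_mk F hF, h, lift_mk]

theorem map_mk_tmul (f : M →ₗ[k] M') (g : N →ₗ[k] N')
    (hf : ∀ r m, f (ra (op r) m) = ra' (op r) (f m)) (hg : ∀ r n, g (la r n) = la' r (g n))
    (m : M) (n : N) :
    map f g hf hg (mk ra la (m ⊗ₜ[k] n)) = mk ra' la' (f m ⊗ₜ[k] g n) := rfl

theorem hom_ext {f g : BalTensor ra la →ₗ[k] V}
    (h : ∀ m n, f (mk ra la (m ⊗ₜ[k] n)) = g (mk ra la (m ⊗ₜ[k] n))) : f = g :=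
  Submodule.linearMap_qext _ (TensorProduct.ext' h)

theorem induction_on {p : BalTensor ra la → Prop} (x : BalTensor ra la)
    (tmul : ∀ m n, p (mk ra la (m ⊗ₜ[k] n))) (zero : p 0) (add : ∀ x y, p x → p y → p (x + y)) :
    p x := by
  obtain ⟨z, rfl⟩ := mk_surjective x
  induction z with
  | zero => simpa using zero
  | tmul m n => exact tmul m n
  | add x y hx hy => rw [map_add]; exact add _ _ hx hy

end BalTensor

/-! ### The diagonal product on `E ⊗_R M` -/

namespace BialgebroidData

variable {k R E M Q : Type*} [CommRing k] [Ring R] [Algebra k R] [Ring E] [Algebra k E]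
  [AddCommGroup M] [Module k M]
  [AddCommGroup Q] [Module k Q] [Module E Q] [IsScalarTower k E Q]
  (D : BialgebroidData k R E)

theorem tmk_balanced (la : R →ₐ[k] Module.End k M) (r : R) (x : E) (m : M) :
    D.tmk la ((D.target (op r) * x) ⊗ₜ[k] m) = D.tmk la (x ⊗ₜ[k] la r m) :=
  BalTensor.mk_balanced r x m

theorem comulTensor_tmul (la : R →ₐ[k] Module.End k M) (h : E) (m : M) :
    D.comulTensor la (h ⊗ₜ[k] m) = D.assocAt la m (D.comul h) := rfl

theorem tensorAct_mk (la : R →ₐ[k] Module.End k M) (r : R) (h : E) (m : M) :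
    D.tensorAct la r (D.tmk la (h ⊗ₜ[k] m)) = D.tmk la ((D.source r * h) ⊗ₜ[k] m) := rfl

theorem assocAt_mk (la : R →ₐ[k] Module.End k M) (m : M) (x y : E) :
    D.assocAt la m (D.tmk D.lact (x ⊗ₜ[k] y)) =
      D.tmk (D.tensorAct la) (x ⊗ₜ[k] D.tmk la (y ⊗ₜ[k] m)) := rfl

@[simp] theorem resAct_apply (L : E →ₐ[k] Module.End k M) (r : R) (m : M) :
    D.resAct L r m = L (D.source r) m := rfl

@[simp] theorem lact_apply (r : R) (x : E) : D.lact r x = D.source r * x := rfl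

@[simp] theorem ract_apply (r : R) (x : E) : D.ract (op r) x = D.target (op r) * x := rfl

@[simp] theorem bract_apply (r : R) (x : E) : D.bract (op r) x = x * D.source r := rfl

/-- The left `R`-action on a left `E`-module obtained from the source map. -/
noncomputable abbrev sact (Q : Type*) [AddCommGroup Q] [Module k Q] [Module E Q]
    [IsScalarTower k E Q] : R →ₐ[k] Module.End k Q := D.resAct (smulHom k E Q)

/-- `E ⊗_R Q` for a left `E`-module `Q`. -/
abbrev Free (Q : Type*) [AddCommGroup Q] [Module k Q] [Module E Q]
    [IsScalarTower k E Q] := D.Tensor (D.sact Q)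

/-- The projection `E ⊗[k] Q → E ⊗_R Q`. -/
noncomputable abbrev fmk (Q : Type*) [AddCommGroup Q] [Module k Q] [Module E Q]
    [IsScalarTower k E Q] : E ⊗[k] Q →ₗ[k] D.Free Q := D.tmk (D.sact Q)

theorem fmk_balanced (r : R) (x : E) (q : Q) :
    D.fmk Q ((D.target (op r) * x) ⊗ₜ[k] q) = D.fmk Q (x ⊗ₜ[k] (D.source r • q)) :=
  D.tmk_balanced _ r x q

theorem diagLeft_tmul {Ω : Type*} [AddCommGroup Ω] [Module k Ω] (L : E →ₐ[k] Module.End k Ω)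
    (x y g : E) (ω : Ω) : diagLeft L (x ⊗ₜ[k] y) (g ⊗ₜ[k] ω) = (x * g) ⊗ₜ[k] L y ω := rfl

theorem diagRight_tmul {Ω : Type*} [AddCommGroup Ω] [Module k Ω]
    (Rt : Eᵐᵒᵖ →ₐ[k] Module.End k Ω) (x y g : E) (ω : Ω) :
    diagRight Rt (x ⊗ₜ[k] y) (g ⊗ₜ[k] ω) = (g * x) ⊗ₜ[k] Rt (op y) ω := rfl

theorem diagLeft_mul {Ω : Type*} [AddCommGroup Ω] [Module k Ω] (L : E →ₐ[k] Module.End k Ω)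
    (z z' : E ⊗[k] E) (w : E ⊗[k] Ω) :
    diagLeft L (z * z') w = diagLeft L z (diagLeft L z' w) := by
  induction w with
  | zero => simp
  | add w w' hw hw' => simp only [map_add, hw, hw']
  | tmul g ω =>
    induction z with
    | zero => simp
    | add x y hx hy => simp only [add_mul, map_add, LinearMap.add_apply, hx, hy]
    | tmul x y =>
      induction z' with
      | zero => simp
      | add x y hx hy => simp only [mul_add, map_add, LinearMap.add_apply, hx, hy]
      | tmul x' y' => simp [diagLeft_tmul, mul_assoc]

/-- The product `(x ⊗_R y)(g ⊗ q) = x g ⊗_R y q`, on representatives `g ⊗ q`. -/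
noncomputable def diagProd (L : E →ₐ[k] Module.End k M) :
    D.Tensor D.lact →ₗ[k] (E ⊗[k] M →ₗ[k] D.Tensor (D.resAct L)) :=
  BalTensor.lift (LinearMap.compRight k (D.tmk (D.resAct L)) ∘ₗ diagLeft L) (fun r m n => by
    refine TensorProduct.ext' fun g q => ?_
    simpa [diagLeft_tmul, mul_assoc] using D.tmk_balanced (D.resAct L) r (m * g) (L n q))

theorem diagProd_mk (L : E →ₐ[k] Module.End k M) (z : E ⊗[k] E) (w : E ⊗[k] M) :
    D.diagProd L (D.tmk D.lact z) w = D.tmk (D.resAct L) (diagLeft L z w) := rfl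

variable {D}

namespace IsLeftBialgebroid

/-- The Takeuchi condition, multiplied into `g ⊗ m`: `h₁ t(r) g ⊗ h₂ m = h₁ g ⊗ h₂ s(r) m`. It is
what makes the diagonal left action well defined. -/
theorem diagProd_comul_balanced (hD : D.IsLeftBialgebroid) (L : E →ₐ[k] Module.End k M) (h : E) (r : R) (g : E) (m : M) :
    D.diagProd L (D.comul h) (D.ract (op r) g ⊗ₜ[k] m) =
      D.diagProd L (D.comul h) (g ⊗ₜ[k] D.resAct L r m) := by
  obtain ⟨z, hz⟩ := BalTensor.mk_surjective (D.comul h)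
  have e := congrArg (fun u => D.diagProd L u (g ⊗ₜ[k] m)) (hD.takeuchi r h z hz)
  simp only [diagProd_mk, diagLeft_mul, diagLeft_tmul] at e
  rw [← hz, diagProd_mk, diagProd_mk]
  simpa using e

end IsLeftBialgebroid
end BialgebroidData

/-! ### The two actions and the coaction on `E ⊗_R Q` -/

namespace BialgebroidData

variable {k R E M Q : Type*} [CommRing k] [Ring R] [Algebra k R] [Ring E] [Algebra k E]
  [AddCommGroup M] [Module k M]
  [AddCommGroup Q] [Module k Q] [Module E Q] [IsScalarTower k E Q]
  {D : BialgebroidData k R E}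

/-- The right action `(g ⊗ q) x = g x ⊗ q` on `E ⊗_R Q`. -/
noncomputable def rightAct (D : BialgebroidData k R E) (Q : Type*) [AddCommGroup Q] [Module k Q]
    [Module E Q] [IsScalarTower k E Q] : Eᵐᵒᵖ →ₐ[k] Module.End k (D.Free Q) :=
  AlgHom.ofLinearMap
    { toFun := fun x => BalTensor.map (LinearMap.mulRight k x.unop) LinearMap.id
        (fun r g => by simp [mul_assoc]) (fun _ _ => rfl)
      map_add' := fun x y => by
        refine BalTensor.hom_ext fun g q => ?_
        change D.fmk Q ((g * (x.unop + y.unop)) ⊗ₜ[k] q) =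
          D.fmk Q ((g * x.unop) ⊗ₜ[k] q) + D.fmk Q ((g * y.unop) ⊗ₜ[k] q)
        rw [mul_add, TensorProduct.add_tmul, map_add]
      map_smul' := fun c x => by
        refine BalTensor.hom_ext fun g q => ?_
        change D.fmk Q ((g * (c • x.unop)) ⊗ₜ[k] q) = c • D.fmk Q ((g * x.unop) ⊗ₜ[k] q)
        rw [mul_smul_comm, ← TensorProduct.smul_tmul', map_smul] }
    (by
      refine BalTensor.hom_ext fun g q => ?_
      simp [-Submodule.mkQ_apply, BalTensor.map_mk_tmul])
    (fun x y => by
      refine BalTensor.hom_ext fun g q => ?_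
      change D.fmk Q ((g * (y.unop * x.unop)) ⊗ₜ[k] q) = D.fmk Q ((g * y.unop * x.unop) ⊗ₜ[k] q)
      rw [mul_assoc])

theorem rightAct_mk (x g : E) (q : Q) :
    D.rightAct Q (op x) (D.fmk Q (g ⊗ₜ[k] q)) = D.fmk Q ((g * x) ⊗ₜ[k] q) := rfl

namespace IsLeftBialgebroid

variable (hD : D.IsLeftBialgebroid)

/-- The diagonal left action `x (g ⊗ q) = x₁ g ⊗ x₂ q` on `E ⊗_R Q`. -/
noncomputable def leftAct (Q : Type*) [AddCommGroup Q] [Module k Q]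
    [Module E Q] [IsScalarTower k E Q] : E →ₐ[k] Module.End k (D.Free Q) :=
  AlgHom.ofLinearMap
    { toFun := fun x => BalTensor.lift (D.diagProd (smulHom k E Q) (D.comul x))
        (fun r g q => hD.diagProd_comul_balanced (smulHom k E Q) x r g q)
      map_add' := fun x y => by
        refine BalTensor.hom_ext fun g q => ?_
        simp [-Submodule.mkQ_apply]
      map_smul' := fun c x => by
        refine BalTensor.hom_ext fun g q => ?_
        simp [-Submodule.mkQ_apply] }
    (by
      refine BalTensor.hom_ext fun g q => ?_
      simp [-Submodule.mkQ_apply, hD.comul_one, diagProd_mk, diagLeft_tmul])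
    (fun x y => by
      obtain ⟨z, hz⟩ := BalTensor.mk_surjective (D.comul x)
      obtain ⟨z', hz'⟩ := BalTensor.mk_surjective (D.comul y)
      refine BalTensor.hom_ext fun g q => ?_
      simp only [LinearMap.coe_mk, AddHom.coe_mk, BalTensor.lift_mk, Module.End.mul_apply]
      rw [hD.comul_mul x y z z' hz hz', ← hz', diagProd_mk, diagProd_mk, diagLeft_mul,
        BalTensor.lift_mk, ← hz, diagProd_mk])

theorem leftAct_mk (x : E) (w : E ⊗[k] Q) (z : E ⊗[k] E) (hz : D.tmk D.lact z = D.comul x) :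
    hD.leftAct Q x (D.fmk Q w) = D.fmk Q (diagLeft (smulHom k E Q) z w) := by
  change D.diagProd _ (D.comul x) w = _
  rw [← hz, diagProd_mk]

/-- Left `R`-linearity of the coproduct, evaluated at `1`. -/
theorem comul_source (hD : D.IsLeftBialgebroid) (r : R) :
    D.comul (D.source r) = D.tmk D.lact (D.source r ⊗ₜ[k] 1) := by
  have := hD.comodule.map_lact r 1
  rwa [hD.comul_one, lact_apply, mul_one, tensorAct_mk, mul_one] at this

/-- The diagonal action restricted along `s` touches the first factor only. Hence `resAct (leftAct
Q)` agrees with the action of `R` on the first factor, and maps built from `g ↦ g ⊗ q` are balanced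
for it. -/
theorem leftAct_source (r : R) (g : E) (q : Q) :
    hD.leftAct Q (D.source r) (D.fmk Q (g ⊗ₜ[k] q)) = D.fmk Q ((D.source r * g) ⊗ₜ[k] q) := by
  rw [hD.leftAct_mk _ _ _ (hD.comul_source r).symm, diagLeft_tmul, map_one]
  rfl

theorem bimodule (x y : E) (ω : D.Free Q) :
    hD.leftAct Q x (D.rightAct Q (op y) ω) = D.rightAct Q (op y) (hD.leftAct Q x ω) := by
  obtain ⟨z, hz⟩ := BalTensor.mk_surjective (D.comul x)
  induction ω using BalTensor.induction_on with
  | zero => simp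
  | add ω ω' h h' => simp only [map_add, h, h']
  | tmul g q =>
    rw [rightAct_mk, hD.leftAct_mk x _ z hz, hD.leftAct_mk x _ z hz]
    clear hz
    induction z with
    | zero => simp
    | add z z' h h' => simp only [map_add, LinearMap.add_apply, h, h']
    | tmul a b => simp [-Submodule.mkQ_apply, diagLeft_tmul, rightAct_mk, mul_assoc]

/-- The map `id ⊗ ι_q`, where `ι_q(g) = g ⊗ q`. -/
noncomputable def insertMap (q : Q) :
    D.Tensor D.lact →ₗ[k] D.Tensor (D.resAct (hD.leftAct Q)) :=
  BalTensor.map LinearMap.id (D.fmk Q ∘ₗ (TensorProduct.mk k E Q).flip q)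
    (fun _ _ => rfl) (fun r g => (hD.leftAct_source r g q).symm)

theorem insertMap_mk_tmul (q : Q) (x y : E) :
    hD.insertMap q (D.tmk D.lact (x ⊗ₜ[k] y)) =
      D.tmk (D.resAct (hD.leftAct Q)) (x ⊗ₜ[k] D.fmk Q (y ⊗ₜ[k] q)) := rfl

/-- `insertMap` as a linear map in `q`. -/
noncomputable def insertLin (Q : Type*) [AddCommGroup Q] [Module k Q]
    [Module E Q] [IsScalarTower k E Q] :
    Q →ₗ[k] D.Tensor D.lact →ₗ[k] D.Tensor (D.resAct (hD.leftAct Q)) where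
  toFun := hD.insertMap
  map_add' q q' := BalTensor.hom_ext fun x y => by
    simp [-Submodule.mkQ_apply, insertMap_mk_tmul, TensorProduct.tmul_add]
  map_smul' c q := BalTensor.hom_ext fun x y => by
    simp [-Submodule.mkQ_apply, insertMap_mk_tmul]

/-- The coaction `λ(g ⊗ q) = g₁ ⊗ (g₂ ⊗ q)` on `E ⊗_R Q`. -/
noncomputable def coaction (Q : Type*) [AddCommGroup Q] [Module k Q]
    [Module E Q] [IsScalarTower k E Q] :
    D.Free Q →ₗ[k] D.Tensor (D.resAct (hD.leftAct Q)) :=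
  BalTensor.lift (TensorProduct.lift ((hD.insertLin Q).flip ∘ₗ D.comul)) (fun r g q => by
    obtain ⟨z, hz⟩ := BalTensor.mk_surjective (D.comul g)
    simp only [ract_apply, TensorProduct.lift.tmul, LinearMap.comp_apply, LinearMap.flip_apply]
    -- The coproduct sends `t(r)` to its second leg, where the inner balanced tensor product turns
    -- it into `s(r)` acting on `q`.
    rw [hD.comul_ract r g z hz, ← hz]
    clear hz
    induction z with
    | zero => simp
    | add z z' h h' => simp only [mul_add, map_add, h, h']
    | tmul a b =>
      change hD.insertMap q _ = hD.insertMap _ _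
      rw [Algebra.TensorProduct.tmul_mul_tmul, insertMap_mk_tmul, fmk_balanced, one_mul]
      rfl)

theorem coaction_mk (g : E) (q : Q) :
    hD.coaction Q (D.fmk Q (g ⊗ₜ[k] q)) = hD.insertMap q (D.comul g) := rfl

theorem coaction_map_lact (r : R) (ω : D.Free Q) :
    hD.coaction Q (D.resAct (hD.leftAct Q) r ω) =
      D.tensorAct (D.resAct (hD.leftAct Q)) r (hD.coaction Q ω) := by
  induction ω using BalTensor.induction_on with
  | zero => simp
  | add ω ω' h h' => simp only [map_add, h, h']
  | tmul g q =>
    rw [resAct_apply, hD.leftAct_source, coaction_mk, coaction_mk, ← lact_apply,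
      hD.comodule.map_lact]
    generalize D.comul g = u
    induction u using BalTensor.induction_on with
    | zero => simp
    | add ω ω' h h' => simp only [map_add, h, h']
    | tmul x y => rfl

end IsLeftBialgebroid
end BialgebroidData

/-! ### Independence of representatives, comodule axioms and right covariance -/

namespace BialgebroidData
namespace IsLeftBialgebroid

variable {k R E M N Q : Type*} [CommRing k] [Ring R] [Algebra k R] [Ring E] [Algebra k E]
  [AddCommGroup M] [Module k M] [AddCommGroup N] [Module k N]
  [AddCommGroup Q] [Module k Q] [Module E Q] [IsScalarTower k E Q]
  {D : BialgebroidData k R E}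

/-- Since `ε(t(r') h s(r)) = ε(h s(r)) r'`. The axioms used are passed individually, here and in the
next lemma, because both also serve to construct a bialgebroid. -/
theorem contract_balanced
    (hc : ∀ (r r' : R) (h : E),
      D.counit (D.source r * D.target (op r') * h) = r * D.counit h * r')
    (la : R →ₐ[k] Module.End k M) (r r' : R)
    (h : E) (m : M) :
    D.contract la r (D.ract (op r') h ⊗ₜ[k] m) = D.contract la r (h ⊗ₜ[k] la r' m) := by
  have := hc 1 r' (h * D.source r)
  rw [map_one, one_mul, one_mul] at this
  simp [contract, mul_assoc, this]

/-- The factor `t(r)` moves to the second leg of `Δ(h)`, which is itself balanced against `m`. -/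
theorem comulTensor_balanced
    (hr : ∀ (r : R) (h : E) (z : E ⊗[k] E), D.tmk D.lact z = D.comul h →
      D.comul (D.target (op r) * h) = D.tmk D.lact ((1 ⊗ₜ[k] D.target (op r)) * z))
    (la : R →ₐ[k] Module.End k M) (r : R)
    (h : E) (m : M) :
    D.comulTensor la (D.ract (op r) h ⊗ₜ[k] m) = D.comulTensor la (h ⊗ₜ[k] la r m) := by
  obtain ⟨z, hz⟩ := BalTensor.mk_surjective (D.comul h)
  rw [comulTensor_tmul, comulTensor_tmul, ract_apply, hr r h z hz, ← hz]
  clear hz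
  induction z with
  | zero => simp
  | add x y hx hy => simp only [mul_add, map_add, hx, hy]
  | tmul x y =>
    rw [Algebra.TensorProduct.tmul_mul_tmul, assocAt_mk, assocAt_mk, tmk_balanced, one_mul]

theorem lTensor_balanced {la : R →ₐ[k] Module.End k M} {la' : R →ₐ[k] Module.End k N}
    {f : M →ₗ[k] N} (hf : ∀ r m, f (la r m) = la' r (f m)) (r : R) (x : E) (m : M) :
    (D.tmk la' ∘ₗ LinearMap.lTensor E f) (D.ract (op r) x ⊗ₜ[k] m) =
      (D.tmk la' ∘ₗ LinearMap.lTensor E f) (x ⊗ₜ[k] la r m) := by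
  simp only [LinearMap.comp_apply, LinearMap.lTensor_tmul, hf, ract_apply]
  exact D.tmk_balanced la' r x (f m)

/-- To check that a linear map is a left comodule it suffices to use one representative of each
coaction. -/
theorem isLeftComodule_of_exists
    (hc : ∀ (r r' : R) (h : E),
      D.counit (D.source r * D.target (op r') * h) = r * D.counit h * r')
    (hr : ∀ (r : R) (h : E) (z : E ⊗[k] E), D.tmk D.lact z = D.comul h →
      D.comul (D.target (op r) * h) = D.tmk D.lact ((1 ⊗ₜ[k] D.target (op r)) * z))
    {la : R →ₐ[k] Module.End k M}
    {lam : M →ₗ[k] D.Tensor la}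
    (map_lact : ∀ r m, lam (la r m) = D.tensorAct la r (lam m))
    (h : ∀ m : M, ∃ z : E ⊗[k] M, D.tmk la z = lam m ∧
      D.tmk (D.tensorAct la) (LinearMap.lTensor E lam z) = D.comulTensor la z ∧
      D.contract la 1 z = m) : D.IsLeftComodule la lam where
  map_lact := map_lact
  coassoc m z hz := by
    obtain ⟨z', hz', hc, -⟩ := h m
    have e := hz.trans hz'.symm
    rw [BalTensor.eq_of_mk_eq (D.comulTensor la) (comulTensor_balanced hr la) e, ← hc]
    exact BalTensor.eq_of_mk_eq (D.tmk (D.tensorAct la) ∘ₗ LinearMap.lTensor E lam)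
      (lTensor_balanced map_lact) e
  counit m z hz := by
    obtain ⟨z', hz', -, hz''⟩ := h m
    rw [BalTensor.eq_of_mk_eq (D.contract la 1) (contract_balanced hc la 1) (hz.trans hz'.symm),
      hz'']

/-- Naturality of `Δ ⊗ id`. Applied to `g ↦ g ⊗ q`, it carries coassociativity from `E` to `E ⊗_R
Q`. -/
theorem comulTensor_lTensor (D : BialgebroidData k R E) {la : R →ₐ[k] Module.End k M}
    {la' : R →ₐ[k] Module.End k N}
    {f : M →ₗ[k] N} (hf : ∀ r m, f (la r m) = la' r (f m)) (z : E ⊗[k] M) :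
    D.comulTensor la' (LinearMap.lTensor E f z) =
      BalTensor.map LinearMap.id (BalTensor.map LinearMap.id f (fun _ _ => rfl) hf)
        (fun _ _ => rfl) (fun r u => by
          induction u using BalTensor.induction_on with
          | zero => simp
          | add ω ω' h h' => simp only [map_add, h, h']
          | tmul x y => rfl) (D.comulTensor la z) := by
  induction z with
  | zero => simp
  | add x y hx hy => simp only [map_add, hx, hy]
  | tmul x m =>
    rw [LinearMap.lTensor_tmul, comulTensor_tmul, comulTensor_tmul]
    generalize D.comul x = u
    induction u using BalTensor.induction_on with
    | zero => simp
    | add ω ω' h h' => simp only [map_add, h, h']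
    | tmul x y => rfl

variable (hD : D.IsLeftBialgebroid)

/-- The map `ι_q : g ↦ g ⊗ q` to `E ⊗_R Q`. -/
noncomputable def insertAt (D : BialgebroidData k R E) (q : Q) : E →ₗ[k] D.Free Q :=
  D.fmk Q ∘ₗ (TensorProduct.mk k E Q).flip q

theorem insertAt_lact (q : Q) (r : R) (g : E) :
    insertAt D q (D.lact r g) = D.resAct (hD.leftAct Q) r (insertAt D q g) :=
  (hD.leftAct_source r g q).symm

/-- Colinearity of `g ↦ g ⊗ q`. The images of these maps span `E ⊗_R Q`, so identities for the
coaction reduce to identities for `Δ`. -/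
theorem coaction_insertAt (q : Q) (g : E) (z : E ⊗[k] E) (hz : D.tmk D.lact z = D.comul g) :
    hD.coaction Q (insertAt D q g) =
      D.tmk (D.resAct (hD.leftAct Q)) (LinearMap.lTensor E (insertAt D q) z) := by
  change hD.insertMap q (D.comul g) = _
  rw [← hz]
  rfl

theorem coaction_coassoc_insertAt (q : Q) (g : E) (z : E ⊗[k] E)
    (hz : D.tmk D.lact z = D.comul g) :
    D.tmk (D.tensorAct (D.resAct (hD.leftAct Q)))
      (LinearMap.lTensor E (hD.coaction Q) (LinearMap.lTensor E (insertAt D q) z)) =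
    D.comulTensor (D.resAct (hD.leftAct Q)) (LinearMap.lTensor E (insertAt D q) z) := by
  rw [comulTensor_lTensor D (hD.insertAt_lact q), ← hD.comodule.coassoc g z hz]
  clear hz
  induction z with
  | zero => simp
  | add x y hx hy => simp only [map_add, hx, hy]
  | tmul x m => rfl

theorem contract_lTensor (D : BialgebroidData k R E) {la : R →ₐ[k] Module.End k M}
    {la' : R →ₐ[k] Module.End k N}
    {f : M →ₗ[k] N} (hf : ∀ r m, f (la r m) = la' r (f m)) (r : R) (z : E ⊗[k] M) :
    D.contract la' r (LinearMap.lTensor E f z) = f (D.contract la r z) := by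
  induction z with
  | zero => simp
  | add x y hx hy => simp only [map_add, hx, hy]
  | tmul x m => simp [contract, hf]

/-- A property of the elements `z ∈ E ⊗ Ω` that represent `λ(ω)`, which is given by an equality of
balanced maps, holds if it holds for one representative of `λ(g ⊗ q)`. -/
theorem forall_coaction_rep {V : Type*} [AddCommGroup V] [Module k V]
    {F : E ⊗[k] D.Free Q →ₗ[k] V} {G : D.Free Q →ₗ[k] V}
    (hF : ∀ r x m, F (D.ract (op r) x ⊗ₜ[k] m) = F (x ⊗ₜ[k] D.resAct (hD.leftAct Q) r m))
    (h : ∀ (q : Q) (g : E) (z : E ⊗[k] E), D.tmk D.lact z = D.comul g →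
      F (LinearMap.lTensor E (insertAt D q) z) = G (insertAt D q g))
    (ω : D.Free Q) (z : E ⊗[k] D.Free Q)
    (hz : D.tmk (D.resAct (hD.leftAct Q)) z = hD.coaction Q ω) : F z = G ω := by
  rw [← BalTensor.lift_mk F hF, hz]
  have : (BalTensor.lift F hF) ∘ₗ hD.coaction Q = G := BalTensor.hom_ext fun g q => by
    obtain ⟨z, hz⟩ := BalTensor.mk_surjective (D.comul g)
    change BalTensor.lift F hF (hD.coaction Q (insertAt D q g)) = G (insertAt D q g)
    rw [hD.coaction_insertAt q g z hz, ← h q g z hz]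
    rfl
  exact LinearMap.congr_fun this ω

theorem coaction_isLeftComodule :
    D.IsLeftComodule (D.resAct (hD.leftAct Q)) (hD.coaction Q) where
  map_lact := hD.coaction_map_lact
  coassoc m z hz := by
    refine sub_eq_zero.1 (hD.forall_coaction_rep (G := 0)
      (F := D.tmk (D.tensorAct (D.resAct (hD.leftAct Q))) ∘ₗ LinearMap.lTensor E (hD.coaction Q) -
        D.comulTensor (D.resAct (hD.leftAct Q))) (fun r x m => ?_) (fun q g z hz => ?_) m z hz)
    · rw [LinearMap.sub_apply, LinearMap.sub_apply, comulTensor_balanced hD.comul_ract,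
        lTensor_balanced hD.coaction_map_lact]
    · exact sub_eq_zero.2 (hD.coaction_coassoc_insertAt q g z hz)
  counit := hD.forall_coaction_rep (G := LinearMap.id) (contract_balanced hD.counit_bilinear _ 1)
    (fun q g z hz => by
      rw [contract_lTensor D (hD.insertAt_lact q), hD.comodule.counit g z hz]; rfl)

/-- The left counit law at `g s(r)`, whose coproduct is `g₁ s(r) ⊗ g₂`. -/
theorem contract_comul (hD : D.IsLeftBialgebroid) (r : R) (g : E) (z : E ⊗[k] E)
    (hz : D.tmk D.lact z = D.comul g) :
    D.contract D.lact r z = g * D.source r := by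
  have h := hD.comodule.counit (g * D.source r) (z * (D.source r ⊗ₜ[k] 1))
    (hD.comul_mul g (D.source r) z _ hz (hD.comul_source r).symm).symm
  rw [← h]
  clear h hz
  induction z with
  | zero => simp
  | add x y hx hy => simp only [map_add, add_mul, hx, hy]
  | tmul x m => simp [contract]

theorem coaction_induced_right (r : R) (ω : D.Free Q) (z : E ⊗[k] D.Free Q)
    (hz : D.tmk (D.resAct (hD.leftAct Q)) z = hD.coaction Q ω) :
    D.contract (D.resAct (hD.leftAct Q)) r z = D.rightAct Q (op (D.source r)) ω :=
  hD.forall_coaction_rep (contract_balanced hD.counit_bilinear _ r) (fun q g z hz => by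
    rw [contract_lTensor D (hD.insertAt_lact q), hD.contract_comul r g z hz]; rfl) ω z hz

theorem diagRight_lTensor_insertAt (q : Q) (w z : E ⊗[k] E) :
    diagRight (D.rightAct Q) w (LinearMap.lTensor E (insertAt D q) z) =
      LinearMap.lTensor E (insertAt D q) (z * w) := by
  induction w with
  | zero => simp
  | add x y hx hy => simp only [map_add, LinearMap.add_apply, mul_add, hx, hy]
  | tmul x y =>
    induction z with
    | zero => simp
    | add x y hx hy => simp only [map_add, add_mul, hx, hy]
    | tmul g l => rw [Algebra.TensorProduct.tmul_mul_tmul]; rfl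

/-- The balancing uses left multiplication by `t(r)` and the left action of `s(r)`; both commute
with right multiplication. -/
theorem diagRight_balanced (w : E ⊗[k] E) (r : R) (x : E) (ω : D.Free Q) :
    (D.tmk (D.resAct (hD.leftAct Q)) ∘ₗ diagRight (D.rightAct Q) w) (D.ract (op r) x ⊗ₜ[k] ω) =
    (D.tmk (D.resAct (hD.leftAct Q)) ∘ₗ diagRight (D.rightAct Q) w)
      (x ⊗ₜ[k] D.resAct (hD.leftAct Q) r ω) := by
  induction w with
  | zero => simp
  | add x y hx hy =>
    simp only [map_add, LinearMap.comp_apply, LinearMap.add_apply] at hx hy ⊢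
    rw [hx, hy]
  | tmul a b =>
    rw [LinearMap.comp_apply, LinearMap.comp_apply, diagRight_tmul, diagRight_tmul, resAct_apply,
      ← hD.bimodule, ract_apply, mul_assoc]
    exact D.tmk_balanced _ r _ _

theorem coaction_takeuchi (r : R) (ω : D.Free Q) (z : E ⊗[k] D.Free Q)
    (hz : D.tmk (D.resAct (hD.leftAct Q)) z = hD.coaction Q ω) :
    D.tmk (D.resAct (hD.leftAct Q)) (diagRight (D.rightAct Q) (D.target (op r) ⊗ₜ[k] 1) z) =
      D.tmk (D.resAct (hD.leftAct Q)) (diagRight (D.rightAct Q) (1 ⊗ₜ[k] D.source r) z) := by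
  refine sub_eq_zero.1 (hD.forall_coaction_rep (G := 0)
    (F := D.tmk (D.resAct (hD.leftAct Q)) ∘ₗ
        diagRight (D.rightAct Q) (D.target (op r) ⊗ₜ[k] 1) -
      D.tmk (D.resAct (hD.leftAct Q)) ∘ₗ diagRight (D.rightAct Q) (1 ⊗ₜ[k] D.source r))
    (fun r x m => ?_) (fun q g z hz => ?_) ω z hz)
  · rw [LinearMap.sub_apply, LinearMap.sub_apply, hD.diagRight_balanced, hD.diagRight_balanced]
  · rw [LinearMap.sub_apply, LinearMap.zero_apply, sub_eq_zero, LinearMap.comp_apply, LinearMap.comp_apply, diagRight_lTensor_insertAt,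
      diagRight_lTensor_insertAt]
    exact congrArg (hD.insertMap q) (hD.takeuchi r g z hz)

theorem coaction_right_compat (h : E) (ω : D.Free Q) (z : E ⊗[k] E) (w : E ⊗[k] D.Free Q)
    (hz : D.tmk D.lact z = D.comul h)
    (hw : D.tmk (D.resAct (hD.leftAct Q)) w = hD.coaction Q ω) :
    hD.coaction Q (D.rightAct Q (op h) ω) =
      D.tmk (D.resAct (hD.leftAct Q)) (diagRight (D.rightAct Q) z w) := by
  refine (hD.forall_coaction_rep (G := hD.coaction Q ∘ₗ D.rightAct Q (op h))
    (F := D.tmk (D.resAct (hD.leftAct Q)) ∘ₗ diagRight (D.rightAct Q) z)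
    (hD.diagRight_balanced z) (fun q g z' hz' => ?_) ω w hw).symm
  rw [LinearMap.comp_apply, diagRight_lTensor_insertAt]
  exact (hD.coaction_insertAt q (g * h) (z' * z) (hD.comul_mul g h z' z hz' hz).symm).symm

end IsLeftBialgebroid
end BialgebroidData

/-! ### Compatibility of the coaction with the diagonal left action -/

namespace BialgebroidData
namespace IsLeftBialgebroid

variable {k R E Q : Type*} [CommRing k] [Ring R] [Algebra k R] [Ring E] [Algebra k E]
  [AddCommGroup Q] [Module k Q] [Module E Q] [IsScalarTower k E Q]
  {D : BialgebroidData k R E} (hD : D.IsLeftBialgebroid)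

/-- The map `x ⊗ y ↦ x g ⊗ y q`. -/
noncomputable def diagAt (D : BialgebroidData k R E) (g : E) (q : Q) :
    D.Tensor D.lact →ₗ[k] D.Free Q :=
  BalTensor.map (LinearMap.mulRight k g) ((smulHom k E Q).toLinearMap.flip q)
    (fun r x => by simp [mul_assoc]) (fun r x => by simp)

theorem diagAt_mk (x y g : E) (q : Q) :
    diagAt D g q (D.tmk D.lact (x ⊗ₜ[k] y)) = D.fmk Q ((x * g) ⊗ₜ[k] (y • q)) := rfl

theorem leftAct_insertAt (h g : E) (q : Q) :
    hD.leftAct Q h (insertAt D q g) = diagAt D g q (D.comul h) := by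
  obtain ⟨z, hz⟩ := BalTensor.mk_surjective (D.comul h)
  refine (hD.leftAct_mk h (g ⊗ₜ[k] q) z hz).trans ?_
  rw [← hz]
  clear hz
  induction z with
  | zero => simp
  | add x y hx hy => simp only [map_add, LinearMap.add_apply, hx, hy]
  | tmul x y => rfl

/-- The map `x ⊗ (y ⊗ v) ↦ x c ⊗ (y d ⊗ v q)`. -/
noncomputable def diagAt₂ (c d : E) (q : Q) :
    D.Tensor (D.tensorAct D.lact) →ₗ[k] D.Tensor (D.resAct (hD.leftAct Q)) :=
  BalTensor.map (LinearMap.mulRight k c) (diagAt D d q) (fun r x => by simp [mul_assoc])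
    (fun r u => by
      induction u using BalTensor.induction_on with
      | zero => simp
      | add u v hu hv => simp only [map_add, hu, hv]
      | tmul x y =>
        rw [diagAt_mk, tensorAct_mk, diagAt_mk, resAct_apply, hD.leftAct_source, mul_assoc])

theorem diagAt₂_mk (c d : E) (q : Q) (x : E) (u : D.Tensor D.lact) :
    hD.diagAt₂ c d q (D.tmk (D.tensorAct D.lact) (x ⊗ₜ[k] u)) =
      D.tmk (D.resAct (hD.leftAct Q)) ((x * c) ⊗ₜ[k] diagAt D d q u) := rfl

/-- For `ω = g ⊗ q` and `Δ(g) = ∑ cᵢ ⊗ dᵢ`, both sides of `λ(hω) = Δ(h)λ(ω)` are values of the same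
map `∑ diagAt₂ cᵢ dᵢ q`. Here it is evaluated at `(Δ ⊗ id)Δ(h)` when `z` represents `Δ(h)`. -/
theorem diagAt₂_comulTensor {n : ℕ} (c d : Fin n → E) (g : E)
    (hg : D.tmk D.lact (∑ i, c i ⊗ₜ[k] d i) = D.comul g) (q : Q) (z : E ⊗[k] E) :
    hD.coaction Q (D.fmk Q (diagLeft (smulHom k E Q) z (g ⊗ₜ[k] q))) =
      ∑ i, hD.diagAt₂ (c i) (d i) q (D.comulTensor D.lact z) := by
  induction z with
  | zero => simp
  | add x y hx hy => simp only [map_add, LinearMap.add_apply, hx, hy, Finset.sum_add_distrib]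
  | tmul x y =>
    obtain ⟨z, hz⟩ := BalTensor.mk_surjective (D.comul x)
    rw [diagLeft_tmul, coaction_mk, hD.comul_mul x g z _ hz hg, comulTensor_tmul, ← hz]
    clear hz
    induction z with
    | zero => simp
    | add x y hx hy => simp only [map_add, add_mul, hx, hy, Finset.sum_add_distrib]
    | tmul p r =>
      rw [Finset.mul_sum, map_sum, map_sum]
      refine Finset.sum_congr rfl fun i _ => ?_
      rw [Algebra.TensorProduct.tmul_mul_tmul]
      rfl

/-- The other side of the comparison: the same map at `(id ⊗ Δ)Δ(h)` when `z` represents `Δ(h)`.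
Coassociativity then identifies the two. -/
theorem diagAt₂_comul {n : ℕ} (c d : Fin n → E) (q : Q) (z : E ⊗[k] E) :
    D.tmk (D.resAct (hD.leftAct Q)) (diagLeft (hD.leftAct Q) z
      (LinearMap.lTensor E (insertAt D q) (∑ i, c i ⊗ₜ[k] d i))) =
      ∑ i, hD.diagAt₂ (c i) (d i) q
        (D.tmk (D.tensorAct D.lact) (LinearMap.lTensor E D.comul z)) := by
  induction z with
  | zero => simp
  | add x y hx hy => simp only [map_add, LinearMap.add_apply, hx, hy, Finset.sum_add_distrib]
  | tmul x y =>
    rw [map_sum, map_sum, map_sum]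
    refine Finset.sum_congr rfl fun i _ => ?_
    rw [LinearMap.lTensor_tmul, LinearMap.lTensor_tmul, diagLeft_tmul, diagAt₂_mk,
      hD.leftAct_insertAt]

theorem coaction_left_compat (h : E) (ω : D.Free Q) (z : E ⊗[k] E) (w : E ⊗[k] D.Free Q)
    (hz : D.tmk D.lact z = D.comul h)
    (hw : D.tmk (D.resAct (hD.leftAct Q)) w = hD.coaction Q ω) :
    hD.coaction Q (hD.leftAct Q h ω) =
      D.tmk (D.resAct (hD.leftAct Q)) (diagLeft (hD.leftAct Q) z w) := by
  rw [← diagProd_mk, hz]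
  refine (hD.forall_coaction_rep (G := hD.coaction Q ∘ₗ hD.leftAct Q h)
    (F := D.diagProd (hD.leftAct Q) (D.comul h))
    (fun r g m => hD.diagProd_comul_balanced _ h r g m) (fun q g z' hz' => ?_) ω w hw).symm
  -- `diagAt₂` is defined for a fixed pair `c, d`, so a representative of `Δ(g)` is written as a
  -- finite sum of pure tensors.
  obtain ⟨n, c, d, rfl⟩ := TensorProduct.exists_sum_tmul_eq z'
  rw [← hz, diagProd_mk, diagAt₂_comul, hD.comodule.coassoc h z hz,
    ← hD.diagAt₂_comulTensor c d g hz' q z, ← hD.leftAct_mk h _ z hz]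
  rfl

theorem isLeftCovariantBimodule :
    D.IsLeftCovariantBimodule (hD.leftAct Q) (D.rightAct Q) (hD.coaction Q) where
  bimodule := hD.bimodule
  comodule := hD.coaction_isLeftComodule
  induced_right := hD.coaction_induced_right
  takeuchi := hD.coaction_takeuchi
  left_compat := hD.coaction_left_compat
  right_compat := hD.coaction_right_compat

end IsLeftBialgebroid
end BialgebroidData

/-! ### The differential `(id ⊗ p)Δ` -/

namespace BialgebroidData

/-- The map `id ⊗ p : E ⊗_R E → E ⊗_R Q` for a left `R`-linear map `p`. -/
noncomputable def tensorMap {k R E Q : Type*} [CommRing k] [Ring R] [Algebra k R] [Ring E]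
    [Algebra k E] [AddCommGroup Q] [Module k Q] [Module E Q] [IsScalarTower k E Q]
    (D : BialgebroidData k R E) (p : E →ₗ[k] Q)
    (hp : ∀ r x, p (D.source r * x) = D.source r • p x) : D.Tensor D.lact →ₗ[k] D.Free Q :=
  BalTensor.map LinearMap.id p (fun _ _ => rfl) hp

variable {k R E Q : Type*} [CommRing k] [Ring R] [Algebra k R] [Ring E] [Algebra k E]
  [AddCommGroup Q] [Module k Q] [Module E Q] [IsScalarTower k E Q]
  {D : BialgebroidData k R E} {p : E →ₗ[k] Q}
  (hp : ∀ r x, p (D.source r * x) = D.source r • p x)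

theorem tensorMap_mk (x y : E) :
    D.tensorMap p hp (D.tmk D.lact (x ⊗ₜ[k] y)) = D.fmk Q (x ⊗ₜ[k] p y) := rfl

namespace IsLeftBialgebroid

variable (hD : D.IsLeftBialgebroid)

/-- The right counit law `t(ε(h₂)) h₁ = h`, pushed through a linear map `f`. -/
theorem lift_counit_right (hD : D.IsLeftBialgebroid) {V : Type*} [AddCommGroup V] [Module k V]
    (h : E) (z : E ⊗[k] E) (hz : D.tmk D.lact z = D.comul h) (f : E →ₗ[k] V)
    (F : E ⊗[k] E →ₗ[k] V)
    (hF : ∀ x y, F (x ⊗ₜ[k] y) = f (D.target (op (D.counit y)) * x)) : F z = f h := by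
  rw [← hD.counit_right h z hz]
  exact LinearMap.congr_fun (g := f ∘ₗ _) (TensorProduct.ext' hF) z

/-- The Takeuchi condition multiplied on the right by `x ⊗ 1`, followed by `id ⊗ p`: a source factor
inside `p` becomes a target factor acting from the right. -/
theorem tensorMap_mul_source (hD : D.IsLeftBialgebroid) (h x : E) (r : R) (z : E ⊗[k] E)
    (hz : D.tmk D.lact z = D.comul h) :
    D.tensorMap p hp (D.tmk D.lact (z * (x ⊗ₜ[k] D.source r))) =
      D.rightAct Q (op (D.target (op r) * x)) (D.tensorMap p hp (D.comul h)) := by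
  have e := congrArg (fun u => D.rightAct Q (op x) (D.tensorMap p hp u)) (hD.takeuchi r h z hz)
  rw [← hz]
  have h1 : ∀ w : E ⊗[k] E, D.rightAct Q (op x) (D.tensorMap p hp (D.tmk D.lact
      (w * (1 ⊗ₜ[k] D.source r)))) =
      D.tensorMap p hp (D.tmk D.lact (w * (x ⊗ₜ[k] D.source r))) := by
    intro w
    induction w with
    | zero => simp
    | add x y hx hy => simp only [map_add, add_mul, hx, hy]
    | tmul a b =>
      rw [Algebra.TensorProduct.tmul_mul_tmul, Algebra.TensorProduct.tmul_mul_tmul, mul_one,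
        tensorMap_mk, tensorMap_mk, rightAct_mk]
  have h2 : ∀ w : E ⊗[k] E, D.rightAct Q (op x) (D.tensorMap p hp (D.tmk D.lact
      (w * (D.target (op r) ⊗ₜ[k] 1)))) =
      D.rightAct Q (op (D.target (op r) * x)) (D.tensorMap p hp (D.tmk D.lact w)) := by
    intro w
    induction w with
    | zero => simp
    | add x y hx hy => simp only [map_add, add_mul, hx, hy]
    | tmul a b =>
      rw [Algebra.TensorProduct.tmul_mul_tmul, mul_one,
        tensorMap_mk, tensorMap_mk, rightAct_mk, rightAct_mk, mul_assoc]
  rw [← h1, ← h2]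
  exact e.symm

/-- The Leibniz rule. The hypothesis on `p` splits `h₁h'₁ ⊗ p(h₂h'₂)` into `h d(h')` and a
remainder, which the Takeuchi condition and the right counit law collapse to `d(h)h'`. -/
theorem tensorMap_comul_mul
    (hmul : ∀ x y, p (x * y) = x • p y + p (x * D.source (D.counit y))) (h h' : E) :
    D.tensorMap p hp (D.comul (h * h')) =
      D.rightAct Q (op h') (D.tensorMap p hp (D.comul h)) +
        hD.leftAct Q h (D.tensorMap p hp (D.comul h')) := by
  obtain ⟨z, hz⟩ := BalTensor.mk_surjective (D.comul h)
  obtain ⟨z', hz'⟩ := BalTensor.mk_surjective (D.comul h')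
  -- The remainder `x ⊗ y ↦ h₁ x ⊗ p(h₂ s(ε(y)))`.
  let F : E ⊗[k] E →ₗ[k] D.Free Q :=
    D.tensorMap p hp ∘ₗ D.tmk D.lact ∘ₗ LinearMap.mulLeft k z ∘ₗ
      LinearMap.lTensor E (D.source.toLinearMap ∘ₗ D.counit)
  have hF : F z' = D.rightAct Q (op h') (D.tensorMap p hp (D.comul h)) :=
    hD.lift_counit_right h' z' hz'
      ((D.rightAct Q).toLinearMap.flip (D.tensorMap p hp (D.comul h)) ∘ₗ
        (opLinearEquiv k).toLinearMap) F
      (fun x y => hD.tensorMap_mul_source hp h x (D.counit y) z hz)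
  have hG : ∀ w : E ⊗[k] E, D.tensorMap p hp (D.tmk D.lact (z * w)) =
      F w + hD.leftAct Q h (D.tensorMap p hp (D.tmk D.lact w)) := by
    intro w
    induction w with
    | zero => simp
    | add x y hx hy =>
      rw [mul_add, map_add, map_add, hx, hy]
      simp only [map_add]
      abel
    | tmul x y =>
      rw [tensorMap_mk, hD.leftAct_mk h _ z hz]
      change _ = D.tensorMap p hp (D.tmk D.lact (z * (x ⊗ₜ[k] D.source (D.counit y)))) + _
      clear hF F hz
      induction z with
      | zero => simp
      | add x y hx hy =>
        simp only [map_add, add_mul, hx, hy, LinearMap.add_apply]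
        abel
      | tmul a b =>
        rw [Algebra.TensorProduct.tmul_mul_tmul, Algebra.TensorProduct.tmul_mul_tmul,
          tensorMap_mk, tensorMap_mk, hmul, TensorProduct.tmul_add, map_add, add_comm]
        rfl
  rw [hD.comul_mul h h' z z' hz hz', hG, hF, hz']

/-- Coassociativity of `Δ` with `p` applied to the last leg. -/
theorem coaction_tensorMap_comul (h : E) (z : E ⊗[k] E) (hz : D.tmk D.lact z = D.comul h) :
    hD.coaction Q (D.tensorMap p hp (D.comul h)) =
      D.tmk (D.resAct (hD.leftAct Q))
        (LinearMap.lTensor E (D.tensorMap p hp ∘ₗ D.comul) z) := by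
  let Θ : D.Tensor (D.tensorAct D.lact) →ₗ[k] D.Tensor (D.resAct (hD.leftAct Q)) :=
    BalTensor.map LinearMap.id (D.tensorMap p hp) (fun _ _ => rfl) (fun r u => by
      induction u using BalTensor.induction_on with
      | zero => simp
      | add u v hu hv => simp only [map_add, hu, hv]
      | tmul x y =>
        rw [tensorAct_mk, tensorMap_mk, tensorMap_mk, resAct_apply, hD.leftAct_source])
  have h1 : ∀ w : E ⊗[k] E, hD.coaction Q (D.tensorMap p hp (D.tmk D.lact w)) =
      Θ (D.comulTensor D.lact w) := by
    intro w
    induction w with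
    | zero => simp
    | add x y hx hy => simp only [map_add, hx, hy]
    | tmul x y =>
      rw [tensorMap_mk, coaction_mk, comulTensor_tmul]
      generalize D.comul x = u
      induction u using BalTensor.induction_on with
      | zero => simp
      | add u v hu hv => simp only [map_add, hu, hv]
      | tmul x y => rfl
  rw [← hz, h1, ← hD.comodule.coassoc h z hz]
  clear hz
  induction z with
  | zero => simp
  | add x y hx hy => simp only [map_add, hx, hy]
  | tmul x y => rfl

theorem span_tensorMap_comul (hH : D.IsRightHopf)
    (hmul : ∀ x y, p (x * y) = x • p y + p (x * D.source (D.counit y)))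
    (hsurj : Function.Surjective p) :
    Submodule.span k {ω | ∃ h h' : E, ω = hD.leftAct Q h (D.tensorMap p hp (D.comul h'))} = ⊤ := by
  obtain ⟨α, hα, -, hs⟩ := hH
  refine eq_top_iff.2 fun ω _ => ?_
  have h1 : ∀ h h' : E, D.rightAct Q (op h') (D.tensorMap p hp (D.comul h)) ∈
      Submodule.span k {ω | ∃ h h' : E, ω = hD.leftAct Q h (D.tensorMap p hp (D.comul h'))} := by
    intro h h'
    -- The Leibniz rule solved for `d(h)h'`.
    rw [← sub_eq_of_eq_add (hD.tensorMap_comul_mul hp hmul h h')]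
    exact Submodule.sub_mem _ (Submodule.subset_span ⟨1, h * h', by simp⟩)
      (Submodule.subset_span ⟨h, h', rfl⟩)
  have h2 : ∀ u, D.tensorMap p hp (α u) ∈
      Submodule.span k {ω | ∃ h h' : E, ω = hD.leftAct Q h (D.tensorMap p hp (D.comul h'))} := by
    intro u
    induction u using BalTensor.induction_on with
    | zero => simp
    | add u v hu hv => rw [map_add, map_add]; exact add_mem hu hv
    | tmul h h' =>
      obtain ⟨z, hz⟩ := BalTensor.mk_surjective (D.comul h)
      rw [hα h h' z hz]
      -- Applying `id ⊗ p` to `h₁h' ⊗ h₂` gives `d(h)h'`.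
      convert h1 h h' using 1
      rw [← hz]
      clear hz
      induction z with
      | zero => simp
      | add x y hx hy => simp only [map_add, add_mul, hx, hy]
      | tmul a b =>
        rw [Algebra.TensorProduct.tmul_mul_tmul, mul_one, tensorMap_mk, tensorMap_mk, rightAct_mk]
  induction ω using BalTensor.induction_on with
  | zero => exact zero_mem _
  | add ω ω' h h' => exact add_mem (h trivial) (h' trivial)
  | tmul g q =>
    obtain ⟨y, rfl⟩ := hsurj q
    obtain ⟨u, hu⟩ := hs (D.tmk D.lact (g ⊗ₜ[k] y))
    have := h2 u
    rwa [hu, tensorMap_mk] at this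

/-- A surjective map `p : E → Q` with `p(s(r) x) = s(r) p(x)` and
`p(x y) = x p(y) + p(x s(ε(y)))` defines the left covariant calculus `E ⊗_R Q` with the
differential `d x = x₁ ⊗ p(x₂)`, if `E` is a right Hopf algebroid. -/
theorem isLeftCovariantCalculus (hH : D.IsRightHopf)
    (hmul : ∀ x y, p (x * y) = x • p y + p (x * D.source (D.counit y)))
    (hsurj : Function.Surjective p) :
    D.IsLeftCovariantCalculus (hD.leftAct Q) (D.rightAct Q) (hD.coaction Q)
      (D.tensorMap p hp ∘ₗ D.comul) where
  calculus :=
    { bimodule := hD.bimodule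
      map_source := fun r r' h => by
        -- The hypothesis at `x = y = 1` reads `p(1) = p(1) + p(1)`. Hence `d` kills the source
        -- image, and the Leibniz rule gives `R`-bilinearity.
        have h1 : p 1 = 0 := by simpa [hD.counit_one] using hmul 1 1
        have h2 : ∀ r, D.tensorMap p hp (D.comul (D.source r)) = 0 := fun r => by
          rw [hD.comul_source, tensorMap_mk, h1, TensorProduct.tmul_zero, map_zero]
        simp only [LinearMap.comp_apply]
        rw [hD.tensorMap_comul_mul hp hmul, hD.tensorMap_comul_mul hp hmul, h2, h2, map_zero,
          map_zero, zero_add, add_zero, hD.bimodule]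
      leibniz := hD.tensorMap_comul_mul hp hmul
      surjective := hD.span_tensorMap_comul hp hH hmul hsurj }
  covariant := hD.isLeftCovariantBimodule
  colinear := hD.coaction_tensorMap_comul hp

/-! ### The projection onto `ker ε` and the induced differential -/

variable {P : Ideal E} (hP : ∀ x, x ∈ P ↔ D.counit x = 0)

theorem counit_source (hD : D.IsLeftBialgebroid) (r : R) : D.counit (D.source r) = r := by
  simpa [hD.counit_one] using hD.counit_bilinear r 1 1

theorem counit_source_mul (hD : D.IsLeftBialgebroid) (r : R) (x : E) :
    D.counit (D.source r * x) = r * D.counit x := by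
  simpa using hD.counit_bilinear r 1 x

/-- The left `R`-linear retraction `x ↦ x - s(ε(x))` of `E` onto `ker ε`. -/
noncomputable def kerProj (hD : D.IsLeftBialgebroid) (hP : ∀ x, x ∈ P ↔ D.counit x = 0) :
    E →ₗ[k] P where
  toFun x := ⟨x - D.source (D.counit x), by
    rw [hP, map_sub, hD.counit_source, sub_self]⟩
  map_add' x y := Subtype.ext (by simp [add_sub_add_comm])
  map_smul' c x := Subtype.ext (by simp [smul_sub])

theorem coe_kerProj (x : E) : (hD.kerProj hP x : E) = x - D.source (D.counit x) := rfl

theorem kerProj_coe (x : P) : hD.kerProj hP x = x :=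
  Subtype.ext (by rw [coe_kerProj, (hP x).1 x.2, map_zero, sub_zero])

theorem kerProj_source_mul (r : R) (x : E) :
    hD.kerProj hP (D.source r * x) = D.source r • hD.kerProj hP x :=
  Subtype.ext (by
    simp only [coe_kerProj, Submodule.coe_smul, hD.counit_source_mul, map_mul, mul_sub,
      smul_eq_mul])

/-- The terms `x s(ε(y))` cancel, and what remains is `ε(xy) = ε(x s(ε(y)))`. -/
theorem kerProj_mul (x y : E) : hD.kerProj hP (x * y) =
    x • hD.kerProj hP y + hD.kerProj hP (x * D.source (D.counit y)) :=
  Subtype.ext (by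
    simp only [coe_kerProj, Submodule.coe_smul, Submodule.coe_add, mul_sub, smul_eq_mul]
    rw [hD.counit_mul_source x y]
    abel)

/-- Balancing and the right counit law give `x₁ ⊗ s(ε(x₂)) = t(ε(x₂))x₁ ⊗ 1 = x ⊗ 1`. -/
theorem tensorIncl_tensorMap_comul (x : E) :
    D.tensorIncl P (D.tensorMap (hD.kerProj hP) (hD.kerProj_source_mul hP) (D.comul x)) =
      D.comul x - D.tmk D.lact (x ⊗ₜ[k] 1) := by
  obtain ⟨z, hz⟩ := BalTensor.mk_surjective (D.comul x)
  rw [← hz]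
  have h1 := hD.lift_counit_right x z hz (D.tmk D.lact ∘ₗ (TensorProduct.mk k E E).flip 1)
    (D.tmk D.lact ∘ₗ LinearMap.lTensor E (D.source.toLinearMap ∘ₗ D.counit)) (fun a b => by
      refine Eq.trans ?_ (D.tmk_balanced D.lact (D.counit b) a 1).symm
      simp)
  change _ = _ - (D.tmk D.lact ∘ₗ (TensorProduct.mk k E E).flip 1) x
  rw [← h1]
  clear h1 hz
  induction z with
  | zero => simp
  | add x y hx hy =>
    simp only [map_add, hx, hy]
    abel
  | tmul a b =>
    rw [tensorMap_mk]
    change D.tmk D.lact (a ⊗ₜ[k] (b - D.source (D.counit b))) =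
      _ - D.tmk D.lact (a ⊗ₜ[k] D.source (D.counit b))
    rw [TensorProduct.tmul_sub, map_sub]

/-- The retraction splits the inclusion of `ker ε` as left `R`-modules, so `E ⊗_R ker ε` embeds into
`E ⊗_R E`. This makes the lift of `Δ(x) - x ⊗ 1` unique. -/
theorem tensorMap_kerProj_tensorIncl (w : D.TensorIdeal P) :
    D.tensorMap (hD.kerProj hP) (hD.kerProj_source_mul hP) (D.tensorIncl P w) = w := by
  induction w using BalTensor.induction_on with
  | zero => simp
  | add u v hu hv => rw [map_add, map_add, hu, hv]
  | tmul a b =>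
    change D.fmk P (a ⊗ₜ[k] hD.kerProj hP b) = _
    rw [kerProj_coe]

/-- The projection `x ↦ [x - s(ε(x))]` of `E` to `ker ε / I`. -/
noncomputable def quotProj (I : Ideal E) : E →ₗ[k] IdealQuot P I :=
  (Submodule.comap P.subtype I).mkQ.restrictScalars k ∘ₗ hD.kerProj hP

theorem quotProj_source_mul (I : Ideal E) (r : R) (x : E) :
    hD.quotProj hP I (D.source r * x) = D.source r • hD.quotProj hP I x := by
  simp only [quotProj, LinearMap.comp_apply, hD.kerProj_source_mul hP]
  rfl

theorem quotProj_mul (I : Ideal E) (x y : E) : hD.quotProj hP I (x * y) =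
    x • hD.quotProj hP I y + hD.quotProj hP I (x * D.source (D.counit y)) := by
  simp only [quotProj, LinearMap.comp_apply]
  rw [hD.kerProj_mul hP x y, map_add]
  rfl

theorem quotProj_surjective (I : Ideal E) : Function.Surjective (hD.quotProj hP I) := fun q => by
  obtain ⟨x, rfl⟩ := Submodule.mkQ_surjective _ q
  exact ⟨x, by simp [quotProj, hD.kerProj_coe hP]⟩

theorem tensorProj_tensorMap (I : Ideal E) (u : D.Tensor D.lact) :
    D.tensorProj P I (D.tensorMap (hD.kerProj hP) (hD.kerProj_source_mul hP) u) =
      D.tensorMap (hD.quotProj hP I) (hD.quotProj_source_mul hP I) u := by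
  induction u using BalTensor.induction_on with
  | zero => simp
  | add u v hu hv => simp only [map_add, hu, hv]
  | tmul a b => rfl

theorem isInducedDifferential (I : Ideal E) : D.IsInducedDifferential P I
    (D.tensorMap (hD.quotProj hP I) (hD.quotProj_source_mul hP I) ∘ₗ D.comul) := fun x => by
  refine ⟨⟨_, hD.tensorIncl_tensorMap_comul hP x⟩, fun w hw => ?_⟩
  rw [LinearMap.comp_apply, ← hD.tensorProj_tensorMap hP I,
    ← hD.tensorMap_kerProj_tensorIncl hP w, hw, ← hD.tensorIncl_tensorMap_comul hP x,
    hD.tensorMap_kerProj_tensorIncl hP]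

theorem isStandardStructure (P I : Ideal E) : D.IsStandardStructure P I
    (hD.leftAct (IdealQuot P I)) (D.rightAct (IdealQuot P I)) (hD.coaction (IdealQuot P I)) where
  left_act h _ _ z hz := hD.leftAct_mk h _ z hz
  right_act _ _ _ := rfl
  coact g q z hz := hD.coaction_insertAt q g z hz

end IsLeftBialgebroid
end BialgebroidData

/-! ### Bialgebroid axioms from one choice of representatives -/

namespace BialgebroidData
namespace IsLeftBialgebroid

variable {k R E : Type*} [CommRing k] [Ring R] [Algebra k R] [Ring E] [Algebra k E]
  {D : BialgebroidData k R E}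

/-- The balancing relations involve left multiplications only, so they survive right multiplication
by any `w`. -/
theorem tmk_mul_congr_left (D : BialgebroidData k R E) (w : E ⊗[k] E) {z z' : E ⊗[k] E}
    (h : D.tmk D.lact z = D.tmk D.lact z') : D.tmk D.lact (z * w) = D.tmk D.lact (z' * w) := by
  refine BalTensor.eq_of_mk_eq (D.tmk D.lact ∘ₗ LinearMap.mulRight k w) (fun r m n => ?_) h
  induction w with
  | zero => simp
  | add x y hx hy =>
    simp only [LinearMap.comp_apply, LinearMap.mulRight_apply, mul_add, map_add] at hx hy ⊢
    rw [hx, hy]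
  | tmul x y =>
    simp only [LinearMap.comp_apply, LinearMap.mulRight_apply,
      Algebra.TensorProduct.tmul_mul_tmul, ract_apply, lact_apply, mul_assoc]
    exact D.tmk_balanced D.lact r _ _

/-- Construction of a left bialgebroid from a linear map `ρ` that chooses representatives
of the coproduct. -/
theorem of_representatives (ρ : E →ₗ[k] E ⊗[k] E) (hρ : ∀ h, D.tmk D.lact (ρ h) = D.comul h)
    (comul_lact : ∀ r h, D.comul (D.source r * h) = D.tmk D.lact ((D.source r ⊗ₜ[k] 1) * ρ h))
    (coassoc : ∀ h, D.tmk (D.tensorAct D.lact) (LinearMap.lTensor E D.comul (ρ h)) =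
      D.comulTensor D.lact (ρ h))
    (counit_left : ∀ h, D.contract D.lact 1 (ρ h) = h)
    (comul_ract : ∀ r h, D.comul (D.target (op r) * h) =
      D.tmk D.lact ((1 ⊗ₜ[k] D.target (op r)) * ρ h))
    (counit_right : ∀ h, TensorProduct.lift ((LinearMap.mul k E).flip.compl₂
      (D.target.toLinearMap ∘ₗ (opLinearEquiv k).toLinearMap ∘ₗ D.counit)) (ρ h) = h)
    (takeuchi : ∀ r h, D.tmk D.lact (ρ h * (D.target (op r) ⊗ₜ[k] 1)) =
      D.tmk D.lact (ρ h * (1 ⊗ₜ[k] D.source r)))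
    (comul_one : D.comul 1 = D.tmk D.lact (1 ⊗ₜ[k] 1))
    (comul_mul : ∀ h h', D.comul (h * h') = D.tmk D.lact (ρ h * ρ h'))
    (counit_one : D.counit 1 = 1)
    (counit_bilinear : ∀ (r r' : R) (h : E),
      D.counit (D.source r * D.target (op r') * h) = r * D.counit h * r')
    (counit_mul_source : ∀ h h' : E, D.counit (h * h') = D.counit (h * D.source (D.counit h')))
    (counit_mul_target : ∀ h h' : E,
      D.counit (h * h') = D.counit (h * D.target (op (D.counit h')))) :
    D.IsLeftBialgebroid := by
  have hr : ∀ (r : R) (h : E) (z : E ⊗[k] E), D.tmk D.lact z = D.comul h →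
      D.comul (D.target (op r) * h) = D.tmk D.lact ((1 ⊗ₜ[k] D.target (op r)) * z) := by
    intro r h z hz
    rw [comul_ract]
    refine BalTensor.eq_of_mk_eq
      (D.tmk D.lact ∘ₗ LinearMap.mulLeft k (1 ⊗ₜ[k] D.target (op r))) (fun r' x y => ?_)
      ((hρ h).trans hz.symm)
    simp only [LinearMap.comp_apply, LinearMap.mulLeft_apply, ract_apply, lact_apply,
      Algebra.TensorProduct.tmul_mul_tmul, one_mul]
    -- Left multiplication by `1 ⊗ t(r)` preserves the relations because source and target commute.
    rw [tmk_balanced, lact_apply, ← mul_assoc, ← mul_assoc, D.commute]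
  exact
  { comodule := isLeftComodule_of_exists counit_bilinear hr
      (fun r h => by
        rw [lact_apply, comul_lact, ← hρ]
        generalize ρ h = z
        induction z with
        | zero => simp
        | add x y hx hy => simp only [mul_add, map_add, hx, hy]
        | tmul x y => rw [Algebra.TensorProduct.tmul_mul_tmul, one_mul]; rfl)
      (fun h => ⟨ρ h, hρ h, coassoc h, counit_left h⟩)
    comul_ract := hr
    counit_right := fun h z hz => by
      refine Eq.trans (BalTensor.eq_of_mk_eq _ (fun r x y => ?_) (hz.trans (hρ h).symm))
        (counit_right h)
      have := counit_bilinear r 1 y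
      rw [op_one, map_one, mul_one, mul_one] at this
      simp [this, mul_assoc]
    takeuchi := fun r h z hz => by
      rw [tmk_mul_congr_left D _ (hz.trans (hρ h).symm),
        tmk_mul_congr_left D _ (hz.trans (hρ h).symm), takeuchi]
    comul_one := comul_one
    comul_mul := fun h h' z z' hz hz' => by
      rw [comul_mul, tmk_mul_congr_left D z' (hz.trans (hρ h).symm)]
      refine BalTensor.eq_of_mk_eq (D.tmk D.lact ∘ₗ LinearMap.mulLeft k (ρ h)) (fun r x y => ?_)
        ((hρ h').trans hz'.symm)
      -- Left multiplication by `ρ h` respects the relations in the second representative by the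
      -- Takeuchi condition.
      have := tmk_mul_congr_left D (x ⊗ₜ[k] y) (takeuchi r h)
      simpa only [LinearMap.comp_apply, LinearMap.mulLeft_apply, ract_apply, lact_apply, mul_assoc,
        Algebra.TensorProduct.tmul_mul_tmul, one_mul] using this
    counit_one := counit_one
    counit_bilinear := counit_bilinear
    counit_mul_source := counit_mul_source
    counit_mul_target := counit_mul_target }

end IsLeftBialgebroid
end BialgebroidData

/-! ### The scalar extension `A # H` is a left bialgebroid -/

namespace BraidedCommAlgebra

variable {k H A : Type*} [CommRing k] [Ring H] [Bialgebra k H] [Ring A] [Algebra k A]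
  (Y : BraidedCommAlgebra k H A)

open BialgebroidData

/-- The map `h ↦ a # h`. -/
noncomputable def smk (a : A) : H →ₗ[k] Y.Smash :=
  Y.ofTensor.toLinearMap ∘ₗ TensorProduct.mk k A H a

theorem smk_apply (a : A) (h : H) : Y.smk a h = Y.ofTensor (a ⊗ₜ[k] h) := rfl

theorem one_eq_smk : (1 : Y.Smash) = Y.smk 1 1 := rfl

theorem source_eq (a : A) : Y.scalarExtension.source a = Y.smk a 1 := rfl

theorem target_eq (a : A) : Y.scalarExtension.target (op a) = Y.ofTensor (Y.coact a) := rfl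

theorem smash_induction {p : Y.Smash → Prop} (x : Y.Smash) (zero : p 0)
    (add : ∀ x y, p x → p y → p (x + y)) (smk : ∀ a h, p (Y.smk a h)) : p x := by
  change p (Y.ofTensor x)
  generalize (show A ⊗[k] H from x) = x
  induction x with
  | zero => simpa using zero
  | tmul a h => exact smk a h
  | add x y hx hy => simpa using add _ _ hx hy

/-- The map `x ⊗ y ↦ a (x · b) # y g`. -/
noncomputable def prodMap (a b : A) (g : H) : H ⊗[k] H →ₗ[k] Y.Smash :=
  Y.ofTensor.toLinearMap ∘ₗ
    TensorProduct.map (LinearMap.mulLeft k a ∘ₗ Y.act.toLinearMap.flip b) (LinearMap.mulRight k g)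

theorem prodMap_tmul (a b : A) (g x y : H) :
    Y.prodMap a b g (x ⊗ₜ[k] y) = Y.smk (a * Y.act x b) (y * g) := rfl

theorem smk_mul_smk (a b : A) (h g : H) :
    Y.smk a h * Y.smk b g = Y.prodMap a b g (Coalgebra.comul h) := by
  change Y.ofTensor (Y.smashMul (a ⊗ₜ[k] h) (b ⊗ₜ[k] g)) = _
  rw [smashMul_tmul, Module.End.mul_apply, diag_tmul]
  generalize Coalgebra.comul (R := k) h = z
  induction z with
  | zero => simp
  | add x y hx hy => simp only [map_add, hx, hy]
  | tmul x y => rfl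

theorem source_mul_smk (r a : A) (h : H) :
    Y.scalarExtension.source r * Y.smk a h = Y.smk (r * a) h := by
  rw [source_eq, smk_mul_smk, Bialgebra.comul_one, Algebra.TensorProduct.one_def, prodMap_tmul,
    map_one, one_mul]
  rfl

theorem target_mul_smk (r a : A) (h : H) : Y.scalarExtension.target (op r) * Y.smk a h =
    Y.ofTensor (TensorProduct.map (LinearMap.mulLeft k a) (LinearMap.mulRight k h) (Y.coact r)) :=
  Y.smashMul_coact r a h

/-- Because `h₁ · 1 = ε(h₁)1`, the counit of `H` removes the first leg. -/
theorem smk_mul_smk_one (a : A) (h g : H) : Y.smk a h * Y.smk 1 g = Y.smk a (h * g) := by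
  have key : ∀ z : H ⊗[k] H, Y.prodMap a 1 g z =
      (Y.smk a ∘ₗ LinearMap.mulRight k g ∘ₗ (TensorProduct.lid k H).toLinearMap)
        (LinearMap.rTensor H Coalgebra.counit z) := by
    intro z
    induction z with
    | zero => simp
    | add x y hx hy => simp only [map_add, hx, hy]
    | tmul x y =>
      rw [prodMap_tmul, Y.act_one, ← Algebra.commutes, ← Algebra.smul_def]
      simp [smk, TensorProduct.smul_tmul']
  rw [smk_mul_smk, key, Coalgebra.rTensor_counit_comul]
  simp

theorem counit_smk (a : A) (h : H) :
    Y.scalarExtension.counit (Y.smk a h) = Coalgebra.counit (R := k) h • a := rfl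

/-- From `t(r)(a # h) = a r₀ # r₁ h` and the counit law of the coaction on `A`. -/
theorem counit_target_mul (r a : A) (h : H) :
    Y.scalarExtension.counit (Y.scalarExtension.target (op r) * Y.smk a h) =
      Coalgebra.counit (R := k) h • (a * r) := by
  have key : ∀ z : A ⊗[k] H, Y.scalarExtension.counit
      (Y.ofTensor (TensorProduct.map (LinearMap.mulLeft k a) (LinearMap.mulRight k h) z)) =
      Coalgebra.counit (R := k) h • (a * TensorProduct.rid k A
        (LinearMap.lTensor A Coalgebra.counit z)) := by
    intro z
    induction z with
    | zero => simp
    | add x y hx hy => simp only [map_add, mul_add, smul_add, hx, hy]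
    | tmul x y =>
      change Y.scalarExtension.counit (Y.smk (a * x) (y * h)) = _
      rw [counit_smk]
      simp [mul_smul, smul_comm (Coalgebra.counit (R := k) h)]
  rw [target_mul_smk, key, Y.counit, TensorProduct.rid_tmul, one_smul]

/-- The representatives `(a # h₁) ⊗ (1 # h₂)` of the coproduct of `A # H`. -/
noncomputable def comulRep : Y.Smash →ₗ[k] Y.Smash ⊗[k] Y.Smash :=
  TensorProduct.map Y.ofTensor.toLinearMap (Y.smk 1) ∘ₗ
    (TensorProduct.assoc k A H H).symm.toLinearMap ∘ₗ
    LinearMap.lTensor A Coalgebra.comul ∘ₗ Y.ofTensor.symm.toLinearMap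

theorem tmk_comulRep (x : Y.Smash) :
    Y.scalarExtension.tmk Y.scalarExtension.lact (Y.comulRep x) = Y.scalarExtension.comul x := rfl

theorem comulRep_smk (a : A) (h : H) : Y.comulRep (Y.smk a h) =
    TensorProduct.map (Y.smk a) (Y.smk 1) (Coalgebra.comul (R := k) h) := by
  change TensorProduct.map Y.ofTensor.toLinearMap (Y.smk 1)
    ((TensorProduct.assoc k A H H).symm (a ⊗ₜ[k] Coalgebra.comul (R := k) h)) = _
  generalize Coalgebra.comul (R := k) h = z
  induction z with
  | zero => simp
  | add x y hx hy => simp only [map_add, TensorProduct.tmul_add, hx, hy]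
  | tmul x y => rfl

/-- The map `x ⊗ y ↦ (a # x) ⊗ (1 # y)`, linear in `a`. -/
noncomputable def smkMap : A →ₗ[k] H ⊗[k] H →ₗ[k] Y.Smash ⊗[k] Y.Smash :=
  TensorProduct.curry (TensorProduct.map Y.ofTensor.toLinearMap (Y.smk 1) ∘ₗ
    (TensorProduct.assoc k A H H).symm.toLinearMap)

theorem smkMap_tmul (a : A) (x y : H) :
    Y.smkMap a (x ⊗ₜ[k] y) = Y.smk a x ⊗ₜ[k] Y.smk 1 y := rfl

theorem smkMap_apply (a : A) (z : H ⊗[k] H) :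
    Y.smkMap a z = TensorProduct.map (Y.smk a) (Y.smk 1) z := by
  have : Y.smkMap a = TensorProduct.map (Y.smk a) (Y.smk 1) := TensorProduct.ext' fun _ _ => rfl
  rw [this]

/-- The coefficient `a` stays in the first leg, so both sides are images of the two iterated
coproducts of `h` under one map `Φ`. -/
theorem comul_coassoc (x : Y.Smash) :
    Y.scalarExtension.tmk (Y.scalarExtension.tensorAct Y.scalarExtension.lact)
      (LinearMap.lTensor Y.Smash Y.scalarExtension.comul (Y.comulRep x)) =
    Y.scalarExtension.comulTensor Y.scalarExtension.lact (Y.comulRep x) := by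
  induction x using Y.smash_induction with
  | zero => simp
  | add x y hx hy => simp only [map_add, hx, hy]
  | smk a h =>
    let Φ := Y.scalarExtension.tmk (Y.scalarExtension.tensorAct Y.scalarExtension.lact) ∘ₗ
      TensorProduct.map (Y.smk a) (Y.scalarExtension.tmk Y.scalarExtension.lact ∘ₗ
        TensorProduct.map (Y.smk 1) (Y.smk 1))
    have h1 : ∀ z : H ⊗[k] H,
        Y.scalarExtension.tmk (Y.scalarExtension.tensorAct Y.scalarExtension.lact)
          (LinearMap.lTensor Y.Smash Y.scalarExtension.comul
            (TensorProduct.map (Y.smk a) (Y.smk 1) z)) =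
        Φ (LinearMap.lTensor H Coalgebra.comul z) := by
      intro z
      induction z with
      | zero => simp
      | add x y hx hy => simp only [map_add, hx, hy]
      | tmul x y =>
        rw [TensorProduct.map_tmul, LinearMap.lTensor_tmul, ← tmk_comulRep, comulRep_smk]
        rfl
    have h2 : ∀ z : H ⊗[k] H,
        Y.scalarExtension.comulTensor Y.scalarExtension.lact
          (TensorProduct.map (Y.smk a) (Y.smk 1) z) =
        Φ (TensorProduct.assoc k H H H (LinearMap.rTensor H Coalgebra.comul z)) := by
      intro z
      induction z with
      | zero => simp
      | add x y hx hy => simp only [map_add, hx, hy]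
      | tmul x y =>
        rw [TensorProduct.map_tmul, LinearMap.rTensor_tmul, comulTensor_tmul, ← tmk_comulRep,
          comulRep_smk]
        generalize Coalgebra.comul (R := k) x = w
        induction w with
        | zero => simp
        | add x y hx hy => simp only [map_add, TensorProduct.add_tmul, hx, hy]
        | tmul x y => rfl
    rw [comulRep_smk, h1, h2, Coalgebra.coassoc_apply]

theorem comulRep_source_mul (r : A) (x : Y.Smash) :
    Y.comulRep (Y.scalarExtension.source r * x) =
      (Y.scalarExtension.source r ⊗ₜ[k] 1) * Y.comulRep x := by
  induction x using Y.smash_induction with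
  | zero => simp
  | add x y hx hy => simp only [map_add, mul_add, hx, hy]
  | smk a h =>
    rw [source_mul_smk, comulRep_smk, comulRep_smk]
    generalize Coalgebra.comul (R := k) h = z
    induction z with
    | zero => simp
    | add x y hx hy => simp only [map_add, mul_add, hx, hy]
    | tmul x y =>
      rw [TensorProduct.map_tmul, TensorProduct.map_tmul, Algebra.TensorProduct.tmul_mul_tmul,
        source_mul_smk, one_mul]

theorem comul_counit_left (x : Y.Smash) :
    Y.scalarExtension.contract Y.scalarExtension.lact 1 (Y.comulRep x) = x := by
  induction x using Y.smash_induction with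
  | zero => simp
  | add x y hx hy => simp only [map_add, hx, hy]
  | smk a h =>
    have key : ∀ z : H ⊗[k] H, Y.scalarExtension.contract Y.scalarExtension.lact 1
        (TensorProduct.map (Y.smk a) (Y.smk 1) z) = (Y.smk a ∘ₗ (TensorProduct.lid k H).toLinearMap)
          (LinearMap.rTensor H Coalgebra.counit z) := by
      intro z
      induction z with
      | zero => simp
      | add x y hx hy => simp only [map_add, hx, hy]
      | tmul x y =>
        simp only [contract, TensorProduct.map_tmul, TensorProduct.lift.tmul, map_one,
          LinearMap.mulRight_one, LinearMap.comp_apply, LinearMap.id_apply, counit_smk,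
          AlgHom.toLinearMap_apply, map_smul, LinearMap.rTensor_tmul,
          LinearEquiv.coe_coe, TensorProduct.lid_tmul]
        rw [LinearMap.smul_apply, lact_apply, source_mul_smk, mul_one]
    rw [comulRep_smk, key, Coalgebra.rTensor_counit_comul]
    simp

theorem comul_counit_right (x : Y.Smash) :
    TensorProduct.lift ((LinearMap.mul k Y.Smash).flip.compl₂
      (Y.scalarExtension.target.toLinearMap ∘ₗ (opLinearEquiv k).toLinearMap ∘ₗ
        Y.scalarExtension.counit)) (Y.comulRep x) = x := by
  induction x using Y.smash_induction with
  | zero => simp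
  | add x y hx hy => simp only [map_add, hx, hy]
  | smk a h =>
    have key : ∀ z : H ⊗[k] H, TensorProduct.lift ((LinearMap.mul k Y.Smash).flip.compl₂
        (Y.scalarExtension.target.toLinearMap ∘ₗ (opLinearEquiv k).toLinearMap ∘ₗ
          Y.scalarExtension.counit))
        (TensorProduct.map (Y.smk a) (Y.smk 1) z) = (Y.smk a ∘ₗ (TensorProduct.rid k H).toLinearMap)
          (LinearMap.lTensor H Coalgebra.counit z) := by
      intro z
      induction z with
      | zero => simp
      | add x y hx hy => simp only [map_add, hx, hy]
      | tmul x y => simp [counit_smk]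
    rw [comulRep_smk, key, Coalgebra.lTensor_counit_comul]
    simp

/-- Both sides equal `(a (h₁·b) # h₂ g₁) ⊗ (1 # h₃ g₂)`, already before balancing; they differ by
coassociativity of `H`. -/
theorem comulRep_mul (x y : Y.Smash) : Y.comulRep (x * y) = Y.comulRep x * Y.comulRep y := by
  induction x using Y.smash_induction with
  | zero => simp
  | add x x' hx hy => simp only [map_add, add_mul, hx, hy]
  | smk a h =>
    induction y using Y.smash_induction with
    | zero => simp
    | add x x' hx hy => simp only [map_add, mul_add, hx, hy]
    | smk b g =>
      rw [smk_mul_smk, comulRep_smk, comulRep_smk, ← smkMap_apply, ← smkMap_apply]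
      -- `G (x ⊗ y) (v ⊗ w) = (a (x·b) # y₁ v) ⊗ (1 # y₂ w)`.
      let G : H ⊗[k] H →ₗ[k] H ⊗[k] H →ₗ[k] Y.Smash ⊗[k] Y.Smash :=
        TensorProduct.lift ((LinearMap.llcomp k _ _ _).compl₁₂
          (Y.smkMap ∘ₗ LinearMap.mulLeft k a ∘ₗ Y.act.toLinearMap.flip b)
          (LinearMap.mul k (H ⊗[k] H) ∘ₗ Coalgebra.comul))
      have h1 : ∀ z, Y.comulRep (Y.prodMap a b g z) = G z (Coalgebra.comul g) := by
        intro z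
        induction z with
        | zero => simp
        | add x y hx hy => simp only [map_add, LinearMap.add_apply, hx, hy]
        | tmul x y =>
          rw [prodMap_tmul, comulRep_smk, Bialgebra.comul_mul, ← smkMap_apply]
          rfl
      rw [h1]
      generalize Coalgebra.comul (R := k) g = v
      induction v with
      | zero => simp
      | add x y hx hy => simp only [map_add, mul_add, hx, hy]
      | tmul c d =>
        let Φ : H ⊗[k] (H ⊗[k] H) →ₗ[k] Y.Smash ⊗[k] Y.Smash :=
          TensorProduct.map (Y.prodMap a b c) (Y.smk 1 ∘ₗ LinearMap.mulRight k d) ∘ₗ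
            (TensorProduct.assoc k H H H).symm.toLinearMap
        have h2 : ∀ z, G z (c ⊗ₜ[k] d) = Φ (LinearMap.lTensor H Coalgebra.comul z) := by
          intro z
          induction z with
          | zero => simp
          | add x y hx hy => simp only [map_add, LinearMap.add_apply, hx, hy]
          | tmul x y =>
            change Y.smkMap (a * Y.act x b) (Coalgebra.comul y * (c ⊗ₜ[k] d)) =
              Φ (x ⊗ₜ[k] Coalgebra.comul y)
            generalize Coalgebra.comul (R := k) y = w
            induction w with
            | zero => simp
            | add x y hx hy => simp only [map_add, add_mul, TensorProduct.tmul_add, hx, hy]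
            | tmul p q => rw [Algebra.TensorProduct.tmul_mul_tmul]; rfl
        have h3 : ∀ z, Y.smkMap a z * Y.smkMap b (c ⊗ₜ[k] d) =
            Φ (TensorProduct.assoc k H H H (LinearMap.rTensor H Coalgebra.comul z)) := by
          intro z
          induction z with
          | zero => simp
          | add x y hx hy => simp only [map_add, add_mul, hx, hy]
          | tmul x y =>
            rw [smkMap_tmul, smkMap_tmul, Algebra.TensorProduct.tmul_mul_tmul, smk_mul_smk,
              smk_mul_smk_one]
            simp [Φ]
        rw [h2, h3, Coalgebra.coassoc_apply]

/-- The left side is `(a r₀ # r₁ h₁) ⊗ (1 # r₂ h₂)`. On the right, `(a # h₁) ⊗ (r₀ # r₁ h₂)` becomes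
the same element when `s(r₀)` crosses the balanced tensor product as `t(r₀)`; coassociativity of the
coaction matches the indices. -/
theorem comul_target_mul (r : A) (x : Y.Smash) :
    Y.scalarExtension.comul (Y.scalarExtension.target (op r) * x) =
      Y.scalarExtension.tmk Y.scalarExtension.lact
        ((1 ⊗ₜ[k] Y.scalarExtension.target (op r)) * Y.comulRep x) := by
  induction x using Y.smash_induction with
  | zero => simp
  | add x x' hx hy => simp only [map_add, mul_add, hx, hy]
  | smk a h =>
    rw [target_mul_smk, comulRep_smk, ← smkMap_apply]
    let G : A ⊗[k] H →ₗ[k] H ⊗[k] H →ₗ[k] Y.Smash ⊗[k] Y.Smash :=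
      TensorProduct.lift ((LinearMap.llcomp k _ _ _).compl₁₂
        (Y.smkMap ∘ₗ LinearMap.mulLeft k a) (LinearMap.mul k (H ⊗[k] H) ∘ₗ Coalgebra.comul))
    have h1 : ∀ z : A ⊗[k] H, Y.comulRep (Y.ofTensor
        (TensorProduct.map (LinearMap.mulLeft k a) (LinearMap.mulRight k h) z)) =
        G z (Coalgebra.comul h) := by
      intro z
      induction z with
      | zero => simp
      | add x y hx hy => simp only [map_add, LinearMap.add_apply, hx, hy]
      | tmul x y =>
        change Y.comulRep (Y.smk (a * x) (y * h)) = _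
        rw [comulRep_smk, Bialgebra.comul_mul, ← smkMap_apply]
        rfl
    rw [← tmk_comulRep, h1]
    generalize Coalgebra.comul (R := k) h = v
    induction v with
    | zero => simp
    | add x y hx hy => simp only [map_add, mul_add, hx, hy]
    | tmul c d =>
      let Φ : A ⊗[k] (H ⊗[k] H) →ₗ[k] Y.Smash ⊗[k] Y.Smash :=
        TensorProduct.map (Y.ofTensor.toLinearMap ∘ₗ
            TensorProduct.map (LinearMap.mulLeft k a) (LinearMap.mulRight k c))
          (Y.smk 1 ∘ₗ LinearMap.mulRight k d) ∘ₗ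
          (TensorProduct.assoc k A H H).symm.toLinearMap
      have h2 : ∀ z, G z (c ⊗ₜ[k] d) = Φ (LinearMap.lTensor A Coalgebra.comul z) := by
        intro z
        induction z with
        | zero => simp
        | add x y hx hy => simp only [map_add, LinearMap.add_apply, hx, hy]
        | tmul x y =>
          change Y.smkMap (a * x) (Coalgebra.comul y * (c ⊗ₜ[k] d)) =
            Φ (x ⊗ₜ[k] Coalgebra.comul y)
          generalize Coalgebra.comul (R := k) y = w
          induction w with
          | zero => simp
          | add x y hx hy => simp only [map_add, add_mul, TensorProduct.tmul_add, hx, hy]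
          | tmul p q => rw [Algebra.TensorProduct.tmul_mul_tmul]; rfl
      have h3 : ∀ z : A ⊗[k] H, Y.scalarExtension.tmk Y.scalarExtension.lact
          (Y.smk a c ⊗ₜ[k] Y.ofTensor (TensorProduct.map (LinearMap.mulLeft k 1)
            (LinearMap.mulRight k d) z)) = Y.scalarExtension.tmk Y.scalarExtension.lact
          (Φ (TensorProduct.assoc k A H H (LinearMap.rTensor H Y.coact z))) := by
        intro z
        induction z with
        | zero => simp
        | add x y hx hy => simp only [map_add, TensorProduct.tmul_add, hx, hy]
        | tmul x y =>
          change Y.scalarExtension.tmk Y.scalarExtension.lact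
            (Y.smk a c ⊗ₜ[k] Y.smk (1 * x) (y * d)) = _
          rw [one_mul, ← mul_one x, ← source_mul_smk, ← lact_apply, ← tmk_balanced, mul_one,
            target_mul_smk]
          simp [Φ]
      rw [smkMap_tmul, Algebra.TensorProduct.tmul_mul_tmul, one_mul, target_mul_smk, h3, h2,
        Y.coassoc]

/-- The map `x ⊗ y ↦ t(y · r) (a # x)`. -/
noncomputable def targetProdMap (r a : A) : H ⊗[k] H →ₗ[k] Y.Smash :=
  TensorProduct.lift ((LinearMap.mul k Y.Smash).flip.compl₁₂ (Y.smk a)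
    (Y.scalarExtension.target.toLinearMap ∘ₗ (opLinearEquiv k).toLinearMap ∘ₗ
      Y.act.toLinearMap.flip r))

theorem targetProdMap_tmul (r a : A) (x y : H) : Y.targetProdMap r a (x ⊗ₜ[k] y) =
    Y.scalarExtension.target (op (Y.act y r)) * Y.smk a x := rfl

/-- The Yetter-Drinfel'd condition as a commutation rule: `(a # h) t(r) = t(h₂·r)(a # h₁)`. -/
theorem smk_mul_target (r a : A) (h : H) :
    Y.smk a h * Y.scalarExtension.target (op r) =
      Y.targetProdMap r a (Coalgebra.comul h) := by
  have h1 : ∀ w : A ⊗[k] H, Y.smk a h * Y.ofTensor w = Y.scalarExtension.source a *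
      Y.ofTensor (TensorProduct.map₂ Y.act.toLinearMap (LinearMap.mul k H)
        (Coalgebra.comul h) w) := by
    intro w
    induction w with
    | zero => simp
    | add x y hx hy => simp only [map_add, mul_add, hx, hy]
    | tmul x y =>
      rw [← smk_apply, smk_mul_smk]
      generalize Coalgebra.comul (R := k) h = z
      induction z with
      | zero => simp
      | add x y hx hy => simp only [map_add, LinearMap.add_apply, mul_add, hx, hy]
      | tmul p q =>
        rw [prodMap_tmul, TensorProduct.map₂_apply_tmul, TensorProduct.map_tmul]
        exact (Y.source_mul_smk _ _ _).symm
  rw [target_eq, h1, Y.compat]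
  generalize Coalgebra.comul (R := k) h = z
  induction z with
  | zero => simp
  | add x y hx hy => simp only [map_add, mul_add, hx, hy]
  | tmul p q =>
    have : Y.smk a p = Y.scalarExtension.source a * Y.smk 1 p := by
      rw [source_mul_smk, mul_one]
    rw [targetProdMap_tmul, this, ← mul_assoc, ← Y.scalarExtension.commute,
      mul_assoc, target_mul_smk, LinearMap.mulLeft_one]
    rfl

/-- Both sides are `t(h₂·r)(a # h₁) ⊗ (1 # h₃)`: on the left by `smk_mul_target`, on the right by
carrying `s(h₂·r)` across the balanced tensor product. -/
theorem comul_takeuchi (r : A) (x : Y.Smash) :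
    Y.scalarExtension.tmk Y.scalarExtension.lact
        (Y.comulRep x * (Y.scalarExtension.target (op r) ⊗ₜ[k] 1)) =
      Y.scalarExtension.tmk Y.scalarExtension.lact
        (Y.comulRep x * (1 ⊗ₜ[k] Y.scalarExtension.source r)) := by
  induction x using Y.smash_induction with
  | zero => simp
  | add x x' hx hy => simp only [map_add, add_mul, hx, hy]
  | smk a h =>
    let Φ : H ⊗[k] (H ⊗[k] H) →ₗ[k] Y.Smash ⊗[k] Y.Smash :=
      TensorProduct.map (Y.targetProdMap r a) (Y.smk 1) ∘ₗ
        (TensorProduct.assoc k H H H).symm.toLinearMap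
    have h1 : ∀ z, Y.smkMap a z * (Y.scalarExtension.target (op r) ⊗ₜ[k] 1) =
        Φ (TensorProduct.assoc k H H H (LinearMap.rTensor H Coalgebra.comul z)) := by
      intro z
      induction z with
      | zero => simp
      | add x y hx hy => simp only [map_add, add_mul, hx, hy]
      | tmul x y =>
        rw [smkMap_tmul, Algebra.TensorProduct.tmul_mul_tmul, smk_mul_target, mul_one]
        simp [Φ]
    have h2 : ∀ z, Y.scalarExtension.tmk Y.scalarExtension.lact
        (Y.smkMap a z * (1 ⊗ₜ[k] Y.scalarExtension.source r)) =
        Y.scalarExtension.tmk Y.scalarExtension.lact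
          (Φ (LinearMap.lTensor H Coalgebra.comul z)) := by
      intro z
      induction z with
      | zero => simp
      | add x y hx hy => simp only [map_add, add_mul, hx, hy]
      | tmul x y =>
        rw [smkMap_tmul, Algebra.TensorProduct.tmul_mul_tmul, source_eq, smk_mul_smk, mul_one,
          LinearMap.lTensor_tmul]
        generalize Coalgebra.comul (R := k) y = w
        induction w with
        | zero => simp
        | add x y hx hy => simp only [map_add, TensorProduct.tmul_add, hx, hy]
        | tmul p q =>
          rw [prodMap_tmul, one_mul, ← mul_one (Y.act p r), ← source_mul_smk, ← lact_apply,
            ← tmk_balanced, mul_one]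
          rfl
    rw [comulRep_smk, ← smkMap_apply, h1, h2, Coalgebra.coassoc_apply]

theorem counit_source (a : A) : Y.scalarExtension.counit (Y.scalarExtension.source a) = a := by
  rw [source_eq, counit_smk, Bialgebra.counit_one, one_smul]

theorem counit_target (a : A) :
    Y.scalarExtension.counit (Y.scalarExtension.target (op a)) = a := by
  rw [← mul_one (Y.scalarExtension.target (op a)), one_eq_smk, counit_target_mul,
    Bialgebra.counit_one, one_smul, one_mul]

/-- The kernel of `ε` is a left ideal. As `s` and `t` are both sections of `ε`, this yields the two
multiplicativity axioms of the counit. -/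
theorem counit_mul_congr (x : Y.Smash) {y y' : Y.Smash}
    (h : Y.scalarExtension.counit y = Y.scalarExtension.counit y') :
    Y.scalarExtension.counit (x * y) = Y.scalarExtension.counit (x * y') := by
  rw [← sub_eq_zero, ← map_sub, ← mul_sub]
  exact Y.counit_smashMul x (y - y') (by
    have := sub_eq_zero.2 h
    rwa [← map_sub] at this)

theorem counit_source_target_mul (r r' : A) (x : Y.Smash) :
    Y.scalarExtension.counit
      (Y.scalarExtension.source r * Y.scalarExtension.target (op r') * x) =
      r * Y.scalarExtension.counit x * r' := by
  induction x using Y.smash_induction with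
  | zero => simp
  | add x x' hx hy => simp only [map_add, mul_add, add_mul, hx, hy]
  | smk a h =>
    rw [Y.scalarExtension.commute, mul_assoc, source_mul_smk, counit_target_mul, counit_smk,
      mul_smul_comm, smul_mul_assoc]

theorem scalarExtension_isLeftBialgebroid : Y.scalarExtension.IsLeftBialgebroid :=
  IsLeftBialgebroid.of_representatives Y.comulRep Y.tmk_comulRep
    (fun r h => by rw [← comulRep_source_mul, tmk_comulRep])
    Y.comul_coassoc Y.comul_counit_left Y.comul_target_mul Y.comul_counit_right Y.comul_takeuchi
    (by
      rw [← tmk_comulRep, one_eq_smk, comulRep_smk, Bialgebra.comul_one]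
      rfl)
    (fun h h' => by rw [← comulRep_mul, tmk_comulRep])
    (by rw [one_eq_smk, counit_smk, Bialgebra.counit_one, one_smul])
    Y.counit_source_target_mul
    (fun h h' => Y.counit_mul_congr h (Y.counit_source _).symm)
    (fun h h' => Y.counit_mul_congr h (Y.counit_target _).symm)

end BraidedCommAlgebra

/-! ### Identities for the inverse antipode -/

namespace HopfAlgebra

variable {k H : Type*} [CommRing k] [Ring H] [HopfAlgebra k H]
  (hS : Function.Bijective (antipode k : H →ₗ[k] H))

/-- The inverse of a bijective antipode. -/
noncomputable def antipodeInv : H →ₗ[k] H := (LinearEquiv.ofBijective (antipode k) hS).symm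

theorem antipode_antipodeInv (h : H) : antipode k (antipodeInv hS h) = h :=
  (LinearEquiv.ofBijective (antipode k) hS).apply_symm_apply h

theorem antipode_algebraMap (c : k) : antipode k (algebraMap k H c) = algebraMap k H c := by
  rw [Algebra.algebraMap_eq_smul_one, map_smul, antipode_one]

/-- `h₂ S⁻¹(h₁) = ε(h)`. -/
theorem mul_antipodeInv_comul (h : H) :
    TensorProduct.lift ((LinearMap.mul k H).flip ∘ₗ antipodeInv hS) (Coalgebra.comul h) =
      algebraMap k H (Coalgebra.counit h) := by
  -- Under the injective, antimultiplicative `S`, the element `h₂ S⁻¹(h₁)` becomes `h₁ S(h₂)`.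
  apply hS.1
  rw [antipode_algebraMap, ← mul_antipode_lTensor_comul_apply]
  generalize Coalgebra.comul (R := k) h = z
  induction z with
  | zero => simp
  | add x y hx hy => simp only [map_add, hx, hy]
  | tmul x y => simp [antipode_mul_antidistrib, antipode_antipodeInv]

/-- `S⁻¹(h₂) h₁ = ε(h)`. -/
theorem antipodeInv_mul_comul (h : H) :
    TensorProduct.lift ((LinearMap.mul k H).flip.compl₂ (antipodeInv hS)) (Coalgebra.comul h) =
      algebraMap k H (Coalgebra.counit h) := by
  -- Here `S` turns `S⁻¹(h₂) h₁` into `S(h₁) h₂`.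
  apply hS.1
  rw [antipode_algebraMap, ← mul_antipode_rTensor_comul_apply]
  generalize Coalgebra.comul (R := k) h = z
  induction z with
  | zero => simp
  | add x y hx hy => simp only [map_add, hx, hy]
  | tmul x y => simp [antipode_mul_antidistrib, antipode_antipodeInv]

/-- Coassociativity gives `m(h₁ ⊗ h₂) ⊗ h₃ = ε(h₁)1 ⊗ h₂ = 1 ⊗ h`. Both antipode identities supply
such an `m`. -/
theorem rTensor_assoc_symm_comul {m : H ⊗[k] H →ₗ[k] H}
    (hm : ∀ h, m (Coalgebra.comul h) = algebraMap k H (Coalgebra.counit h)) (h : H) :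
    LinearMap.rTensor H m ((TensorProduct.assoc k H H H).symm
      (LinearMap.lTensor H Coalgebra.comul (Coalgebra.comul h))) = 1 ⊗ₜ[k] h := by
  have hm' : m ∘ₗ Coalgebra.comul = Algebra.linearMap k H ∘ₗ Coalgebra.counit := LinearMap.ext hm
  rw [Coalgebra.coassoc_symm_apply, ← LinearMap.rTensor_comp_apply, hm',
    LinearMap.rTensor_comp_apply, Coalgebra.rTensor_counit_comul, LinearMap.rTensor_tmul,
    Algebra.linearMap_apply, map_one]

end HopfAlgebra

/-! ### The Galois map of `A # H` and its inverse -/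

namespace BraidedCommAlgebra

open BialgebroidData HopfAlgebra

variable {k H A : Type*} [CommRing k] [Ring H]

section Bialgebra

variable [Bialgebra k H] [Ring A] [Algebra k A] (Y : BraidedCommAlgebra k H A)

theorem comulRep_source (r : A) :
    Y.comulRep (Y.scalarExtension.source r) = Y.scalarExtension.source r ⊗ₜ[k] 1 := by
  rw [source_eq, comulRep_smk, Bialgebra.comul_one]
  rfl

/-- The balanced tensor product by `x s(a) ⊗ y = x ⊗ s(a) y`. -/
abbrev SourceTensor := BalTensor Y.scalarExtension.bract Y.scalarExtension.lact

/-- The projection to the balanced tensor product by `x s(a) ⊗ y = x ⊗ s(a) y`. -/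
noncomputable abbrev smkTensor : Y.Smash ⊗[k] Y.Smash →ₗ[k] Y.SourceTensor :=
  BalTensor.mk Y.scalarExtension.bract Y.scalarExtension.lact

/-- The map `x ⊗ y ↦ x₁ y ⊗ x₂`. -/
noncomputable def galoisMap :
    Y.SourceTensor →ₗ[k] Y.scalarExtension.Tensor Y.scalarExtension.lact :=
  BalTensor.lift (Y.scalarExtension.tmk Y.scalarExtension.lact ∘ₗ
    TensorProduct.lift ((LinearMap.mul k (Y.Smash ⊗[k] Y.Smash)).compl₁₂ Y.comulRep
      ((TensorProduct.mk k Y.Smash Y.Smash).flip 1))) (fun r x y => by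
    simp only [LinearMap.comp_apply, TensorProduct.lift.tmul, LinearMap.compl₁₂_apply, bract_apply,
      lact_apply, LinearMap.mul_apply', LinearMap.flip_apply, TensorProduct.mk_apply, comulRep_mul,
      comulRep_source]
    rw [mul_assoc, Algebra.TensorProduct.tmul_mul_tmul, one_mul])

theorem galoisMap_mk (x y : Y.Smash) : Y.galoisMap (Y.smkTensor (x ⊗ₜ[k] y)) =
    Y.scalarExtension.tmk Y.scalarExtension.lact (Y.comulRep x * (y ⊗ₜ[k] 1)) := rfl

theorem one_smk_mul (x y : H) : Y.smk 1 x * Y.smk 1 y = Y.smk 1 (x * y) :=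
  Y.smk_mul_smk_one 1 x y

end Bialgebra

variable [HopfAlgebra k H] [Ring A] [Algebra k A] (Y : BraidedCommAlgebra k H A)
  (hS : Function.Bijective (antipode k : H →ₗ[k] H))

/-- The map `x ⊗ w ↦ (y ↦ (1 # w) ⊗ (1 # S⁻¹(x)) y)`. -/
noncomputable def twistMap : H ⊗[k] H →ₗ[k] Y.Smash →ₗ[k] Y.SourceTensor :=
  TensorProduct.lift ((LinearMap.llcomp k Y.Smash Y.Smash Y.SourceTensor).flip.compl₁₂
    (LinearMap.mul k Y.Smash ∘ₗ Y.smk 1 ∘ₗ antipodeInv hS)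
    (LinearMap.compRight k Y.smkTensor ∘ₗ TensorProduct.mk k Y.Smash Y.Smash ∘ₗ Y.smk 1))

theorem twistMap_tmul (x w : H) (y : Y.Smash) : Y.twistMap hS (x ⊗ₜ[k] w) y =
    Y.smkTensor (Y.smk 1 w ⊗ₜ[k] (Y.smk 1 (antipodeInv hS x) * y)) := rfl

/-- The map `b # g ↦ (y ↦ (1 # g₂) ⊗ (1 # S⁻¹(g₁)) t(b) y)`. -/
noncomputable def galoisInvCurried : Y.Smash →ₗ[k] Y.Smash →ₗ[k] Y.SourceTensor :=
  TensorProduct.lift ((LinearMap.llcomp k Y.Smash Y.Smash Y.SourceTensor).flip.compl₁₂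
    (LinearMap.mul k Y.Smash ∘ₗ Y.scalarExtension.target.toLinearMap ∘ₗ
      (opLinearEquiv k).toLinearMap) (Y.twistMap hS ∘ₗ Coalgebra.comul)) ∘ₗ
    Y.ofTensor.symm.toLinearMap

theorem galoisInvCurried_smk (b : A) (g : H) (y : Y.Smash) :
    Y.galoisInvCurried hS (Y.smk b g) y =
      Y.twistMap hS (Coalgebra.comul g) (Y.scalarExtension.target (op b) * y) := rfl

/-- The inverse `y ⊗ (b # g) ↦ (1 # g₂) ⊗ (1 # S⁻¹(g₁)) t(b) y` of `galoisMap`. -/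
noncomputable def galoisInv :
    Y.scalarExtension.Tensor Y.scalarExtension.lact →ₗ[k] Y.SourceTensor :=
  BalTensor.lift (TensorProduct.lift (Y.galoisInvCurried hS).flip) (fun r y x => by
    simp only [TensorProduct.lift.tmul, LinearMap.flip_apply, ract_apply, lact_apply]
    induction x using Y.smash_induction with
    | zero => simp
    | add x x' hx hy => simp only [map_add, mul_add, LinearMap.add_apply, hx, hy]
    | smk b g =>
      rw [source_mul_smk, galoisInvCurried_smk, galoisInvCurried_smk, op_mul, map_mul Y.scalarExtension.target,
        mul_assoc])

theorem galoisInv_mk_smk (y : Y.Smash) (b : A) (g : H) :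
    Y.galoisInv hS (Y.scalarExtension.tmk Y.scalarExtension.lact (y ⊗ₜ[k] Y.smk b g)) =
      Y.twistMap hS (Coalgebra.comul g) (Y.scalarExtension.target (op b) * y) := rfl

/-- The composite is `(1 # g₂ S⁻¹(g₁)) y ⊗ (1 # g₃)`, which collapses by `h₂ S⁻¹(h₁) = ε(h)`. -/
theorem galoisMap_twistMap (g : H) (y : Y.Smash) :
    Y.galoisMap (Y.twistMap hS (Coalgebra.comul g) y) =
      Y.scalarExtension.tmk Y.scalarExtension.lact (y ⊗ₜ[k] Y.smk 1 g) := by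
  let Φ : H ⊗[k] H →ₗ[k] Y.scalarExtension.Tensor Y.scalarExtension.lact :=
    Y.scalarExtension.tmk Y.scalarExtension.lact ∘ₗ
      TensorProduct.map (LinearMap.mulRight k y ∘ₗ Y.smk 1) (Y.smk 1)
  let m : H ⊗[k] H →ₗ[k] H := TensorProduct.lift ((LinearMap.mul k H).flip ∘ₗ antipodeInv hS)
  have h1 : ∀ z, Y.galoisMap (Y.twistMap hS z y) =
      Φ (LinearMap.rTensor H m ((TensorProduct.assoc k H H H).symm
        (LinearMap.lTensor H Coalgebra.comul z))) := by
    intro z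
    induction z with
    | zero => simp
    | add x y hx hy => simp only [map_add, LinearMap.add_apply, hx, hy]
    | tmul x w =>
      rw [twistMap_tmul, galoisMap_mk, comulRep_smk, LinearMap.lTensor_tmul]
      generalize Coalgebra.comul (R := k) w = v
      induction v with
      | zero => simp
      | add x y hx hy => simp only [map_add, add_mul, TensorProduct.tmul_add, hx, hy]
      | tmul p q =>
        rw [TensorProduct.map_tmul, Algebra.TensorProduct.tmul_mul_tmul, mul_one, ← mul_assoc,
          one_smk_mul]
        rfl
  rw [h1, rTensor_assoc_symm_comul (mul_antipodeInv_comul hS)]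
  change Y.scalarExtension.tmk _ ((Y.smk 1 1 * y) ⊗ₜ[k] _) = _
  rw [← one_eq_smk, one_mul]

theorem galoisMap_galoisInv (u : Y.scalarExtension.Tensor Y.scalarExtension.lact) :
    Y.galoisMap (Y.galoisInv hS u) = u := by
  induction u using BalTensor.induction_on with
  | zero => simp
  | add u v hu hv => simp only [map_add, hu, hv]
  | tmul y x =>
    induction x using Y.smash_induction with
    | zero => simp
    | add x x' hx hy => simp only [map_add, TensorProduct.tmul_add, hx, hy]
    | smk b g =>
      refine (congrArg Y.galoisMap (Y.galoisInv_mk_smk hS y b g)).trans ?_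
      rw [galoisMap_twistMap, tmk_balanced, lact_apply, source_mul_smk, mul_one]

/-- The composite is `(1 # h₃) ⊗ (1 # S⁻¹(h₂) h₁) y`, which collapses by `S⁻¹(h₂) h₁ = ε(h)`. -/
theorem galoisInv_galoisMap_one_smk (h : H) (y : Y.Smash) :
    Y.galoisInv hS (Y.galoisMap (Y.smkTensor (Y.smk 1 h ⊗ₜ[k] y))) =
      Y.smkTensor (Y.smk 1 h ⊗ₜ[k] y) := by
  let Φ : H ⊗[k] H →ₗ[k] Y.SourceTensor :=
    Y.smkTensor ∘ₗ (TensorProduct.comm k Y.Smash Y.Smash).toLinearMap ∘ₗ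
      TensorProduct.map (LinearMap.mulRight k y ∘ₗ Y.smk 1) (Y.smk 1)
  let m : H ⊗[k] H →ₗ[k] H :=
    TensorProduct.lift ((LinearMap.mul k H).flip.compl₂ (antipodeInv hS))
  have h1 : ∀ z, Y.galoisInv hS (Y.scalarExtension.tmk Y.scalarExtension.lact
      (TensorProduct.map (Y.smk 1) (Y.smk 1) z * (y ⊗ₜ[k] 1))) =
      Φ (LinearMap.rTensor H m ((TensorProduct.assoc k H H H).symm
        (LinearMap.lTensor H Coalgebra.comul z))) := by
    intro z
    induction z with
    | zero => simp
    | add x y hx hy => simp only [map_add, add_mul, hx, hy]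
    | tmul x w =>
      rw [TensorProduct.map_tmul, Algebra.TensorProduct.tmul_mul_tmul, mul_one, galoisInv_mk_smk,
        LinearMap.lTensor_tmul, op_one, map_one, one_mul]
      generalize Coalgebra.comul (R := k) w = v
      induction v with
      | zero => simp
      | add x y hx hy =>
        simp only [map_add, LinearMap.add_apply, TensorProduct.tmul_add, hx, hy]
      | tmul p q =>
        rw [twistMap_tmul, ← mul_assoc, one_smk_mul]
        rfl
  rw [galoisMap_mk, comulRep_smk, h1,
    rTensor_assoc_symm_comul (antipodeInv_mul_comul hS)]
  change Y.smkTensor (_ ⊗ₜ[k] (Y.smk 1 1 * y)) = _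
  rw [← one_eq_smk, one_mul]

/-- The map `x ⊗ w ↦ (1 # w) s(S⁻¹(x) · a)`. -/
noncomputable def mulSourceMap (a : A) : H ⊗[k] H →ₗ[k] Y.Smash :=
  TensorProduct.lift ((LinearMap.mul k Y.Smash).flip.compl₁₂
    (Y.scalarExtension.source.toLinearMap ∘ₗ Y.act.toLinearMap.flip a ∘ₗ antipodeInv hS) (Y.smk 1))

theorem mulSourceMap_tmul (a : A) (x w : H) : Y.mulSourceMap hS a (x ⊗ₜ[k] w) =
    Y.smk 1 w * Y.scalarExtension.source (Y.act (antipodeInv hS x) a) := rfl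

/-- The identity `a # h = (1 # h₂) s(S⁻¹(h₁)·a)` shows that `1 # H` generates `A # H` as a right
module over the source. -/
theorem mulSourceMap_comul (a : A) (h : H) :
    Y.mulSourceMap hS a (Coalgebra.comul h) = Y.smk a h := by
  let m : H ⊗[k] H →ₗ[k] H := TensorProduct.lift ((LinearMap.mul k H).flip ∘ₗ antipodeInv hS)
  have h1 : ∀ z, Y.mulSourceMap hS a z = Y.prodMap 1 a 1
      (LinearMap.rTensor H m ((TensorProduct.assoc k H H H).symm
        (LinearMap.lTensor H Coalgebra.comul z))) := by
    intro z
    induction z with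
    | zero => simp
    | add x y hx hy => simp only [map_add, hx, hy]
    | tmul x w =>
      rw [mulSourceMap_tmul, source_eq, smk_mul_smk, LinearMap.lTensor_tmul]
      generalize Coalgebra.comul (R := k) w = v
      induction v with
      | zero => simp
      | add x y hx hy => simp only [map_add, TensorProduct.tmul_add, hx, hy]
      | tmul p q => simp [m, prodMap_tmul]
  rw [h1, rTensor_assoc_symm_comul (mul_antipodeInv_comul hS), prodMap_tmul]
  simp

theorem galoisInv_galoisMap (u : Y.SourceTensor) : Y.galoisInv hS (Y.galoisMap u) = u := by
  induction u using BalTensor.induction_on with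
  | zero => simp
  | add u v hu hv => simp only [map_add, hu, hv]
  | tmul x y =>
    induction x using Y.smash_induction with
    | zero => simp
    | add x x' hx hy => simp only [map_add, TensorProduct.add_tmul, hx, hy]
    | smk a h =>
      rw [← mulSourceMap_comul Y hS]
      generalize Coalgebra.comul (R := k) h = z
      induction z with
      | zero => simp
      | add x x' hx hy => simp only [map_add, TensorProduct.add_tmul, hx, hy]
      | tmul p q =>
        -- The source factor passes to the second tensor factor, leaving the case of coefficient `1`
        -- in the first.
        rw [mulSourceMap_tmul, ← bract_apply, BalTensor.mk_balanced]
        exact Y.galoisInv_galoisMap_one_smk hS q _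

theorem scalarExtension_isRightHopf (Y : BraidedCommAlgebra k H A)
    (hS : Function.Bijective (antipode k : H →ₗ[k] H)) : Y.scalarExtension.IsRightHopf :=
  ⟨Y.galoisMap, fun x y _ hz =>
    (Y.galoisMap_mk x y).trans (IsLeftBialgebroid.tmk_mul_congr_left _ _ hz.symm),
    Function.LeftInverse.injective (Y.galoisInv_galoisMap hS),
    Function.RightInverse.surjective (Y.galoisMap_galoisInv hS)⟩

theorem smashIdeal_le_plus (IA : Ideal A) (hIA : ∀ (h : H), ∀ a ∈ IA, Y.act h a ∈ IA)
    (IH : Ideal H) (hIH : ∀ h ∈ IH, Coalgebra.counit (R := k) h = 0) :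
    Y.smashIdeal IA IH hIA ≤ Y.plus := fun x hx => by
  have : smashSub (k := k) IA IH ≤
      LinearMap.ker (Y.scalarExtension.counit ∘ₗ Y.ofTensor.toLinearMap) := by
    refine Submodule.span_le.2 ?_
    rintro _ ⟨a, -, h, hh, rfl⟩
    change Y.scalarExtension.counit (Y.smk a h) = 0
    rw [counit_smk, hIH h hh, zero_smul]
  exact this hx

end BraidedCommAlgebra

/-- `(A # H) ⊗_A (A # H)⁺ / (I_A # I_H)` is a left covariant first order differential calculus on
the scalar extension Hopf algebroid `A # H`. -/
theorem proposition3p6 {k H A : Type*} [Field k] [Ring H] [HopfAlgebra k H]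
    (hS : Function.Bijective (HopfAlgebra.antipode k : H →ₗ[k] H))
    [Ring A] [Algebra k A] (Y : BraidedCommAlgebra k H A)
    (IA : Ideal A) (hIA : ∀ (h : H), ∀ a ∈ IA, Y.act h a ∈ IA)
    (IH : Ideal H) (hIH : ∀ h ∈ IH, Coalgebra.counit (R := k) h = 0) :
    Y.scalarExtension.IsLeftBialgebroid ∧ Y.scalarExtension.IsRightHopf ∧
    Y.smashIdeal IA IH hIA ≤ Y.plus ∧
    ∃ (L : Y.Smash →ₐ[k] Module.End k
          (Y.scalarExtension.Forms Y.plus (Y.smashIdeal IA IH hIA)))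
      (Rt : Y.Smashᵐᵒᵖ →ₐ[k] Module.End k
          (Y.scalarExtension.Forms Y.plus (Y.smashIdeal IA IH hIA)))
      (lam : Y.scalarExtension.Forms Y.plus (Y.smashIdeal IA IH hIA) →ₗ[k]
          Y.scalarExtension.Tensor (Y.scalarExtension.resAct L))
      (d : Y.Smash →ₗ[k] Y.scalarExtension.Forms Y.plus (Y.smashIdeal IA IH hIA)),
      Y.scalarExtension.IsStandardStructure Y.plus (Y.smashIdeal IA IH hIA) L Rt lam ∧
      Y.scalarExtension.IsInducedDifferential Y.plus (Y.smashIdeal IA IH hIA) d ∧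
      Y.scalarExtension.IsLeftCovariantCalculus L Rt lam d := by
  have hD := Y.scalarExtension_isLeftBialgebroid
  have hH := Y.scalarExtension_isRightHopf hS
  have hP : ∀ x, x ∈ Y.plus ↔ Y.scalarExtension.counit x = 0 := fun _ => Iff.rfl
  -- The witnesses are `leftAct`, `rightAct` and `coaction` for `Q = (A # H)⁺ / (I_A # I_H)`, and
  -- `(id ⊗ p)Δ` with `p` the map `quotProj`.
  exact ⟨hD, hH, Y.smashIdeal_le_plus IA hIA IH hIH, _, _, _, _,
    hD.isStandardStructure _ _, hD.isInducedDifferential hP _,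
    hD.isLeftCovariantCalculus _ hH (hD.quotProj_mul hP _) (hD.quotProj_surjective hP _)⟩
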